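/- Let $p\ge 1$ and let $(X_t)_{t\in\mathbb Z}$ be a strictly stationary solution of the random-coefficient autoregression $$X_t=\sum_{k=1}^{p}(\theta_k+\alpha_k\,\eta_{k,t-1}+\eta_{k,t})\,X_{t-k}+\varepsilon_t,\qquad t\in\mathbb Z,$$ with $\theta,\alpha\in\mathbb R^p$, where the vectors $(\varepsilon_t,\eta_{1,t},\dots,\eta_{p,t})$, $t\in\mathbb Z$, are i.i.d. with finite variances and pairwise uncorrelated components, all odd moments of $\varepsilon_0$ and of each $\eta_{k,0}$ that exist being zero. Let $C_\theta$ be the companion matrix of $\theta$ (first row $\theta$, ones on the subdiagonal, zeros elsewhere), $N_t$ the $p\times p$ matrix with first row $\eta_t=(\eta_{1,t},\dots,\eta_{p,t})$ and zeros elsewhere, and $D_\alpha=\mathrm{diag}(\alpha_1,\dots,\alpha_p)$. Assume that, for some submultiplicative norm on $\mathbb R^{p\times p}$, $$\mathbb E\big[\ln\|C_\theta+N_0D_\alpha+N_1\|\big]<0\qquad\text{and}\qquad \mathbb E[\ln^+|\varepsilon_0|]<\infty$$ (where $\ln 0=-\infty$ and the first expectation may be $-\infty$). Put $\Phi_t=(X_t,\dots,X_{t-p+1})^T$,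 $\ell_i=\mathbb E[X_iX_0]$, $\Lambda_0=(\ell_{|i-j|})_{1\le i,j\le p}$, $L_1=(\ell_1,\dots,\ell_p)^T$, and let $$\widehat\theta_n=S_{n-1}^{-1}\sum_{t=1}^{n}\Phi_{t-1}X_t,\qquad S_{n-1}=\sum_{t=0}^{n-1}\Phi_t\Phi_t^T,$$ be the ordinary least squares estimator of $\theta$. Assume that $\mathbb E[|\eta_{k,t}|^aX_t^2]<\infty$ for all $a\in\{0,1,2\}$, $1\le k\le p$ and $t\in\mathbb Z$, and that $\Lambda_0$ is invertible. Then, almost surely, $S_{n-1}$ is invertible for all large $n$ and $$\widehat\theta_n\longrightarrow\theta^*=\Lambda_0^{-1}L_1\qquad(n\to\infty).$$ Moreover $\theta^*=\theta+\Lambda_0^{-1}\lambda$ with $\lambda=\mathbb E[\Phi_0\Phi_0^TD_\alpha\,\eta_0]$ (here $\eta_0$ is regarded as a column vector), so that $\theta^*=\theta$ if and only if $\lambda=0$, in particular if $\alpha=0$. Finally, the estimator is in general not consistent when $\alpha\ne0$: for every $p\ge1$ and every nonzero $\alpha\in\mathbb R^p$ there are a parameter $\theta\in\mathbb R^p$,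 noises and a process $(X_t)$ that satisfy all the assumptions above and for which $\theta^*\ne\theta$, so that $\widehat\theta_n$ does not converge to $\theta$ even in probability. -/

import Mathlib

open MeasureTheory ProbabilityTheory Filter Topology Matrix Real

universe u

noncomputable section

namespace RCAR

/-- The companion matrix `C_θ` of the autoregression with coefficients `θ`: first row `θ`,
ones on the subdiagonal, zeros elsewhere. -/
def companion {p : ℕ} (θ : Fin p → ℝ) : Matrix (Fin p) (Fin p) ℝ :=
  Matrix.of fun i j =>
    if (i : ℕ) = 0 then θ j else if (i : ℕ) = (j : ℕ) + 1 then 1 else 0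

/-- The matrix with first row `v` and zeros elsewhere. -/
def firstRow {p : ℕ} (v : Fin p → ℝ) : Matrix (Fin p) (Fin p) ℝ :=
  Matrix.of fun i j => if (i : ℕ) = 0 then v j else 0

/-- The random matrix `C_θ + N_{t-1} D_α + N_t` driving the vector form of the recursion, where
`N_t` has first row `(η_{1,t}, …, η_{p,t})` and `D_α = diag(α_1, …, α_p)`. The coordinates
`1, …, p` are represented by `Fin p`, so that `k : Fin p` stands for the lag `k + 1`. -/
def coeffMatrix {Ω : Type u} {p : ℕ} (θ α : Fin p → ℝ) (η : Fin p → ℤ → Ω → ℝ)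
    (t : ℤ) (ω : Ω) : Matrix (Fin p) (Fin p) ℝ :=
  companion θ + firstRow (fun k => η k (t - 1) ω) * Matrix.diagonal α
    + firstRow (fun k => η k t ω)

/-- `E[ln Y] < 0` for a nonnegative random variable `Y`, with `ln 0 = -∞`: the expectation is
well defined in `[-∞, 0)`, that is, `E[ln⁺ Y] < E[ln⁻ Y]` in `[0, ∞]`. -/
def ExpLogNeg {Ω : Type u} [MeasurableSpace Ω] (P : Measure Ω) (Y : Ω → ℝ) : Prop :=
  ∫⁻ ω, (ENNReal.log (ENNReal.ofReal (Y ω))).toENNReal ∂P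
    < ∫⁻ ω, (-ENNReal.log (ENNReal.ofReal (Y ω))).toENNReal ∂P

/-- The noises: the vectors `(ε_t, η_{1,t}, …, η_{p,t})`, `t ∈ ℤ`, are i.i.d. with finite
variances, their components are pairwise uncorrelated, and every odd moment that exists
(in particular the mean) is zero. -/
structure IsNoise {Ω : Type u} [MeasurableSpace Ω] (P : Measure Ω) {p : ℕ}
    (ε : ℤ → Ω → ℝ) (η : Fin p → ℤ → Ω → ℝ) : Prop where
  measurable_eps : ∀ t, Measurable (ε t)
  measurable_eta : ∀ k t, Measurable (η k t)
  indep : iIndepFun (fun (t : ℤ) (ω : Ω) => (ε t ω, fun k => η k t ω)) P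
  identDistrib : ∀ t : ℤ, IdentDistrib (fun ω => (ε t ω, fun k => η k t ω))
    (fun ω => (ε 0 ω, fun k => η k 0 ω)) P P
  memLp_eps : MemLp (ε 0) 2 P
  memLp_eta : ∀ k, MemLp (η k 0) 2 P
  uncorr_eps_eta : ∀ k, cov[ε 0, η k 0; P] = 0
  uncorr_eta : ∀ k l, k ≠ l → cov[η k 0, η l 0; P] = 0
  odd_eps : ∀ m : ℕ, Odd m → Integrable (fun ω => ε 0 ω ^ m) P → ∫ ω, ε 0 ω ^ m ∂P = 0
  odd_eta : ∀ k, ∀ m : ℕ, Odd m → Integrable (fun ω => η k 0 ω ^ m) P →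
    ∫ ω, η k 0 ω ^ m ∂P = 0

/-- The stability condition: `E[ln ‖C_θ + N_0 D_α + N_1‖] < 0` for some submultiplicative norm
on the `p × p` real matrices, and `E[ln⁺ |ε_0|] < ∞`. -/
structure IsStable {Ω : Type u} [MeasurableSpace Ω] (P : Measure Ω) {p : ℕ}
    (θ α : Fin p → ℝ) (ε : ℤ → Ω → ℝ) (η : Fin p → ℤ → Ω → ℝ) : Prop where
  exp_log_norm_neg : ∃ ν : AlgebraNorm ℝ (Matrix (Fin p) (Fin p) ℝ),
    ExpLogNeg P (fun ω => ν (coeffMatrix θ α η 1 ω))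
  integrable_posLog : Integrable (fun ω => log⁺ |ε 0 ω|) P

/-- `X` is a strictly stationary RCAR(`p`) process with correlated random coefficients:
`X_t = ∑_{k=1}^p (θ_k + α_k η_{k,t-1} + η_{k,t}) X_{t-k} + ε_t`, `t ∈ ℤ`, under the noise and
stability assumptions. -/
structure IsRCAR {Ω : Type u} [MeasurableSpace Ω] (P : Measure Ω) {p : ℕ}
    (θ α : Fin p → ℝ) (ε : ℤ → Ω → ℝ) (η : Fin p → ℤ → Ω → ℝ) (X : ℤ → Ω → ℝ) : Prop where
  noise : IsNoise P ε η
  stable : IsStable P θ α ε η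
  measurable : ∀ t, Measurable (X t)
  recursion : ∀ t : ℤ, ∀ᵐ ω ∂P,
    X t ω = ∑ k : Fin p, (θ k + α k * η k (t - 1) ω + η k t ω) * X (t - ((k : ℤ) + 1)) ω + ε t ω
  stationary : ∀ s : ℤ,
    IdentDistrib (fun ω (t : ℤ) => X (t + s) ω) (fun ω (t : ℤ) => X t ω) P P

/-- Finite second-order moments: `E[|η_{k,t}|^a X_t²] < ∞` for `a ∈ {0, 1, 2}`, all `k`
and all `t`. -/
def FiniteSecondMoments {Ω : Type u} [MeasurableSpace Ω] (P : Measure Ω) {p : ℕ}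
    (η : Fin p → ℤ → Ω → ℝ) (X : ℤ → Ω → ℝ) : Prop :=
  ∀ a : ℕ, a ≤ 2 → ∀ (k : Fin p) (t : ℤ), Integrable (fun ω => η k t ω ^ a * X t ω ^ 2) P

/-- The autocovariances `ℓ_i = E[X_i X_0]`. -/
def autocov {Ω : Type u} [MeasurableSpace Ω] (P : Measure Ω) (X : ℤ → Ω → ℝ) (i : ℕ) : ℝ :=
  ∫ ω, X (i : ℤ) ω * X 0 ω ∂P

/-- The Toeplitz matrix `Λ_0 = (ℓ_{|i-j|})`. -/
def Lambda0 {Ω : Type u} [MeasurableSpace Ω] (P : Measure Ω) (p : ℕ) (X : ℤ → Ω → ℝ) :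
    Matrix (Fin p) (Fin p) ℝ :=
  Matrix.of fun i j => autocov P X ((i : ℤ) - (j : ℤ)).natAbs

/-- The vector `L_1 = (ℓ_1, …, ℓ_p)`. -/
def L1 {Ω : Type u} [MeasurableSpace Ω] (P : Measure Ω) (p : ℕ) (X : ℤ → Ω → ℝ) : Fin p → ℝ :=
  fun i => autocov P X ((i : ℕ) + 1)

/-- The limit `θ* = Λ_0⁻¹ L_1`. -/
def thetaStar {Ω : Type u} [MeasurableSpace Ω] (P : Measure Ω) (p : ℕ) (X : ℤ → Ω → ℝ) :
    Fin p → ℝ :=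
  (Lambda0 P p X)⁻¹ *ᵥ L1 P p X

/-- The vector `λ = E[Φ_0 Φ_0ᵀ D_α η_0]`, with entries
`λ_i = ∑_k α_k E[X_{1-i} X_{1-k} η_{k,0}]`. -/
def biasVec {Ω : Type u} [MeasurableSpace Ω] (P : Measure Ω) {p : ℕ} (α : Fin p → ℝ)
    (η : Fin p → ℤ → Ω → ℝ) (X : ℤ → Ω → ℝ) : Fin p → ℝ :=
  fun i => ∑ k : Fin p, α k * ∫ ω, X (-(i : ℤ)) ω * X (-(k : ℤ)) ω * η k 0 ω ∂P

/-- `Φ_t = (X_t, X_{t-1}, …, X_{t-p+1})`. -/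
def Phi {Ω : Type u} (p : ℕ) (X : ℤ → Ω → ℝ) (t : ℤ) (ω : Ω) : Fin p → ℝ :=
  fun i => X (t - (i : ℤ)) ω

/-- `S_{n-1} = ∑_{t=0}^{n-1} Φ_t Φ_tᵀ`. -/
def gram {Ω : Type u} (p : ℕ) (X : ℤ → Ω → ℝ) (n : ℕ) (ω : Ω) : Matrix (Fin p) (Fin p) ℝ :=
  ∑ t ∈ Finset.range n, Matrix.vecMulVec (Phi p X (t : ℤ) ω) (Phi p X (t : ℤ) ω)

/-- The ordinary least squares estimator `θ̂_n = S_{n-1}⁻¹ ∑_{t=1}^n Φ_{t-1} X_t`. -/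
def ols {Ω : Type u} (p : ℕ) (X : ℤ → Ω → ℝ) (n : ℕ) (ω : Ω) : Fin p → ℝ :=
  (gram p X n ω)⁻¹ *ᵥ ∑ t ∈ Finset.Icc 1 n, X (t : ℤ) ω • Phi p X ((t : ℤ) - 1) ω

end RCAR

end

/-! Consistency rests on causality. Iterating the vector recursion `m` times back from time `t`, the
difference between `Φ_t` and the iterate started at zero is a product of `m` coefficient matrices
applied to `Φ_{t-m}`. Neighbouring coefficient matrices share a noise vector, so they are not
independent, but they are shifts of one function of the i.i.d. noise sequence. The ergodic theorem
applied to a truncation of `ln ‖A_t‖` gives an exponentially decaying product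
(`exists_prod_norm_le_exp`). Finite second moments make `e^{-cm} X_{t-m}` tend to zero. Hence `X_t`
is a shift-equivariant function of the noise up to time `t` (`IsRCAR.exists_causal`).

This has two consequences. The ergodic theorem applies to the products `X_s X_t`, so `n⁻¹ S_{n-1} →
Λ_0` and the normalized cross sums tend to `L_1`; continuity of the inverse at `Λ_0` gives the limit
of the estimator. Moreover `X_s` is independent of later noise: multiplying the recursion at time
`1` by `X_{-i}` and integrating kills the terms in `η_{k,1}` and `ε_1`, but not those in `α_k
η_{k,0}`. So `L_1 = Λ_0 θ + λ` (`IsRCAR.L1_eq`).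

The ergodic theorem is proved only for Bernoulli shifts: the strong law along arithmetic
progressions settles functions of finitely many coordinates, conditional expectations on growing
windows approximate the rest in `L¹`, and Hopf's maximal inequality passes to the limit.

For inconsistency, the noise vector is put on the coordinate axes: at each time exactly one
component is nonzero, with a random sign, so that products of distinct components vanish pointwise.
With `θ = (1/8, 0, …, 0)` and small amplitudes `b_k` the recursion is a contraction with a bounded
stationary solution. Then `λ_1` equals `ℓ_1 / (p + 1)` times a quadratic form in `b`, with
coefficients determined by `α`, that can be made nonzero. If `λ_1` vanished, so would `ℓ_1`, whereas
the first Yule–Walker equation would read `ℓ_1 = ℓ_0 / 8 ≠ 0`. -/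

/-! ### Hopf's maximal inequality and almost sure convergence under `L¹` approximation -/

section MaximalErgodic

variable {S : Type*}

/-- The running maximum `max_{0 ≤ k ≤ N} ∑_{j < k} g (T^j x)` of the Birkhoff sums. -/
noncomputable def birkhoffMax (T : S → S) (g : S → ℝ) : ℕ → S → ℝ
  | 0, _ => 0
  | N + 1, x => max 0 (g x + birkhoffMax T g N (T x))

theorem birkhoffMax_nonneg (T : S → S) (g : S → ℝ) (N : ℕ) (x : S) :
    0 ≤ birkhoffMax T g N x := by
  cases N with
  | zero => exact le_rfl
  | succ N => exact le_max_left _ _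

theorem birkhoffMax_le_succ (T : S → S) (g : S → ℝ) (N : ℕ) (x : S) :
    birkhoffMax T g N x ≤ birkhoffMax T g (N + 1) x := by
  induction N generalizing x with
  | zero => exact birkhoffMax_nonneg _ _ _ _
  | succ N ih => exact max_le_max le_rfl (add_le_add le_rfl (ih (T x)))

theorem birkhoffSum_le_birkhoffMax (T : S → S) (g : S → ℝ) {k N : ℕ} (hk : k ≤ N) (x : S) :
    birkhoffSum T g k x ≤ birkhoffMax T g N x := by
  induction N generalizing k x with
  | zero =>
    obtain rfl : k = 0 := by omega
    simp [birkhoffMax]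
  | succ N ih =>
    rcases k with _ | k
    · simpa using birkhoffMax_nonneg T g (N + 1) x
    · rw [birkhoffSum_succ']
      exact le_trans (add_le_add le_rfl (ih (by omega) (T x))) (le_max_right _ _)

variable [MeasurableSpace S] {μ : Measure S}

theorem integrable_birkhoffMax {T : S → S} (hT : MeasurePreserving T μ μ) {g : S → ℝ}
    (hg : Integrable g μ) (N : ℕ) : Integrable (birkhoffMax T g N) μ := by
  induction N with
  | zero => exact integrable_zero _ _ _
  | succ N ih =>
    exact (integrable_zero _ _ _).sup (hg.add (hT.integrable_comp_of_integrable ih))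

theorem measurable_birkhoffMax {T : S → S} (hT : Measurable T) {g : S → ℝ}
    (hg : Measurable g) (N : ℕ) : Measurable (birkhoffMax T g N) := by
  induction N with
  | zero => exact measurable_const
  | succ N ih => exact measurable_const.max (hg.add (ih.comp hT))

/-- Hopf's maximal ergodic theorem. -/
theorem setIntegral_birkhoffMax_pos_nonneg {T : S → S} (hT : MeasurePreserving T μ μ)
    {g : S → ℝ} (hgm : Measurable g) (hg : Integrable g μ) (N : ℕ) :
    0 ≤ ∫ x in {x | 0 < birkhoffMax T g N x}, g x ∂μ := by
  rcases N with _ | N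
  · simp [birkhoffMax]
  set A := {x | 0 < birkhoffMax T g (N + 1) x}
  have hA : MeasurableSet A :=
    measurableSet_lt measurable_const (measurable_birkhoffMax hT.measurable hgm _)
  have i1 := integrable_birkhoffMax hT hg (N + 1)
  have i2 : Integrable (fun x => birkhoffMax T g N (T x)) μ :=
    hT.integrable_comp_of_integrable (integrable_birkhoffMax hT hg N)
  -- On `A` the second branch of the maximum is active, so `g = M_{N+1} - M_N ∘ T`. Both integrals
  -- over `A` are then compared with integrals over the whole space: `M_{N+1}` vanishes off `A`,
  -- `M_N ∘ T` is nonnegative, and invariance leaves `∫ M_{N+1} - ∫ M_N ≥ 0`.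
  have e : ∫ x in A, g x ∂μ
      = ∫ x in A, birkhoffMax T g (N + 1) x ∂μ - ∫ x in A, birkhoffMax T g N (T x) ∂μ := by
    rw [← integral_sub i1.integrableOn i2.integrableOn]
    refine setIntegral_congr_fun hA fun x hx => ?_
    have hx' : 0 < max 0 (g x + birkhoffMax T g N (T x)) := hx
    have : birkhoffMax T g (N + 1) x = g x + birkhoffMax T g N (T x) :=
      max_eq_right (by by_contra h; simp [max_eq_left (le_of_not_ge h)] at hx')
    simp only [this]
    ring
  have e1 : ∫ x in A, birkhoffMax T g (N + 1) x ∂μ = ∫ x, birkhoffMax T g (N + 1) x ∂μ := by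
    refine setIntegral_eq_integral_of_forall_compl_eq_zero fun x hx => ?_
    exact le_antisymm (not_lt.1 hx) (birkhoffMax_nonneg _ _ _ _)
  have e2 : ∫ x in A, birkhoffMax T g N (T x) ∂μ ≤ ∫ x, birkhoffMax T g N (T x) ∂μ :=
    setIntegral_le_integral i2 (Eventually.of_forall fun x => birkhoffMax_nonneg _ _ _ _)
  have e3 : ∫ x, birkhoffMax T g N (T x) ∂μ = ∫ x, birkhoffMax T g N x ∂μ := by
    have := integral_map hT.measurable.aemeasurable (f := birkhoffMax T g N) (μ := μ)
      (by rw [hT.map_eq]; exact (integrable_birkhoffMax hT hg N).1)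
    rw [hT.map_eq] at this
    exact this.symm
  have e4 : ∫ x, birkhoffMax T g N x ∂μ ≤ ∫ x, birkhoffMax T g (N + 1) x ∂μ :=
    integral_mono (integrable_birkhoffMax hT hg N) i1 (birkhoffMax_le_succ T g N)
  linarith

/-- The weak-type maximal inequality for the Birkhoff averages of a nonnegative function. -/
theorem measure_exists_lt_birkhoffSum_le [IsProbabilityMeasure μ] {T : S → S}
    (hT : MeasurePreserving T μ μ) {h : S → ℝ} (hm : Measurable h) (hi : Integrable h μ)
    (h0 : ∀ x, 0 ≤ h x) {c : ℝ} (hc : 0 < c) :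
    μ {x | ∃ k : ℕ, k * c < birkhoffSum T h k x} ≤ ENNReal.ofReal ((∫ x, h x ∂μ) / c) := by
  -- Subtracting `c` turns an average above `c` into a positive Birkhoff sum, to which Hopf's
  -- theorem applies.
  set A : ℕ → Set S := fun N => {x | 0 < birkhoffMax T (fun y => h y - c) N x}
  have hsub : {x | ∃ k : ℕ, k * c < birkhoffSum T h k x} ⊆ ⋃ N, A N := by
    rintro x ⟨k, hk⟩
    refine Set.mem_iUnion.2 ⟨k, lt_of_lt_of_le ?_ (birkhoffSum_le_birkhoffMax T _ le_rfl x)⟩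
    have : birkhoffSum T (fun y => h y - c) k x = birkhoffSum T h k x - k * c := by
      simp [birkhoffSum, Finset.sum_sub_distrib]
    linarith
  have hmono : Monotone A := monotone_nat_of_le_succ fun N x hx =>
    lt_of_lt_of_le hx (birkhoffMax_le_succ T _ N x)
  refine (measure_mono hsub).trans ?_
  rw [hmono.measure_iUnion]
  refine iSup_le fun N => ?_
  have hA : MeasurableSet (A N) := measurableSet_lt measurable_const
    (measurable_birkhoffMax hT.measurable (hm.sub measurable_const) _)
  have key := setIntegral_birkhoffMax_pos_nonneg hT (hm.sub measurable_const)
    (hi.sub (integrable_const c)) N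
  have key' : 0 ≤ ∫ x in A N, h x ∂μ - μ.real (A N) * c := by
    have : ∫ x in A N, (h x - c) ∂μ = ∫ x in A N, h x ∂μ - μ.real (A N) * c := by
      rw [integral_sub hi.integrableOn (integrable_const c)]
      simp
    rw [← this]
    exact key
  have h2 : ∫ x in A N, h x ∂μ ≤ ∫ x, h x ∂μ :=
    setIntegral_le_integral hi (Eventually.of_forall h0)
  rw [← ofReal_measureReal]
  refine ENNReal.ofReal_le_ofReal ?_
  rw [le_div_iff₀ hc]
  linarith

/-- Almost sure convergence of Birkhoff averages to the mean is stable under approximation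
in `L¹`. -/
theorem ae_tendsto_birkhoffSum_of_approx [IsProbabilityMeasure μ] {T : S → S}
    (hT : MeasurePreserving T μ μ) {f : S → ℝ} (hfm : Measurable f) (hf : Integrable f μ)
    (happ : ∀ δ : ℝ, 0 < δ → ∃ g : S → ℝ, Measurable g ∧ Integrable g μ ∧
      ∫ x, |f x - g x| ∂μ ≤ δ ∧
      ∀ᵐ x ∂μ, Tendsto (fun n : ℕ => birkhoffSum T g n x / n) atTop (𝓝 (∫ x, g x ∂μ))) :
    ∀ᵐ x ∂μ, Tendsto (fun n : ℕ => birkhoffSum T f n x / n) atTop (𝓝 (∫ x, f x ∂μ)) := by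
  -- One `c` each for the averages of `f - g`, for the averages of `g` about their mean, and for the
  -- difference of the two means. Only the first can fail on a set of positive measure, and that
  -- measure is at most `δ / c` with `δ` at our disposal.
  have main : ∀ c : ℝ, 0 < c → ∀ᵐ x ∂μ, ∀ᶠ n : ℕ in atTop,
      |birkhoffSum T f n x / n - ∫ x, f x ∂μ| ≤ 3 * c := by
    intro c hc
    rw [ae_iff]
    have bound : ∀ δ : ℝ, 0 < δ → δ ≤ c → μ {x | ¬ ∀ᶠ n : ℕ in atTop,
        |birkhoffSum T f n x / n - ∫ x, f x ∂μ| ≤ 3 * c} ≤ ENNReal.ofReal (δ / c) := by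
      intro δ hδ hδc
      obtain ⟨g, hgm, hgi, hfg, hgt⟩ := happ δ hδ
      have hmax := measure_exists_lt_birkhoffSum_le hT (h := fun x => |f x - g x|)
        (hfm.sub hgm).abs (hf.sub hgi).abs (fun x => abs_nonneg _) hc
      refine le_trans ?_ (hmax.trans (ENNReal.ofReal_le_ofReal
        (div_le_div_of_nonneg_right hfg hc.le)))
      refine measure_mono_ae ?_
      filter_upwards [hgt] with x hx hbad
      by_contra hgood
      apply hbad
      have hgood' : ∀ k : ℕ, birkhoffSum T (fun x => |f x - g x|) k x ≤ k * c := by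
        intro k
        by_contra hk
        exact hgood ⟨k, not_le.1 hk⟩
      have hev : ∀ᶠ n : ℕ in atTop, |birkhoffSum T g n x / n - ∫ x, g x ∂μ| ≤ c := by
        filter_upwards [Metric.tendsto_nhds.1 hx c hc] with n hn
        exact hn.le
      filter_upwards [hev, eventually_gt_atTop 0] with n hn hn0
      have hn0' : (0 : ℝ) < n := by exact_mod_cast hn0
      have e1 : |∫ x, g x ∂μ - ∫ x, f x ∂μ| ≤ c := by
        rw [← integral_sub hgi hf]
        refine (abs_integral_le_integral_abs).trans ?_
        simp_rw [abs_sub_comm (g _)]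
        exact hfg.trans hδc
      have e2 : |birkhoffSum T f n x / n - birkhoffSum T g n x / n| ≤ c := by
        rw [← sub_div, abs_div, abs_of_pos hn0', div_le_iff₀ hn0', mul_comm]
        refine le_trans ?_ (hgood' n)
        simp only [birkhoffSum, ← Finset.sum_sub_distrib]
        exact Finset.abs_sum_le_sum_abs _ _
      have := abs_sub_le (birkhoffSum T f n x / n) (birkhoffSum T g n x / n) (∫ x, f x ∂μ)
      have := abs_sub_le (birkhoffSum T g n x / n) (∫ x, g x ∂μ) (∫ x, f x ∂μ)
      linarith
    refine le_antisymm (ENNReal.le_of_forall_pos_le_add fun ε hε _ => ?_) zero_le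
    rw [zero_add]
    have hε' : (0 : ℝ) < ε := hε
    refine (bound (min c (ε * c)) (by positivity) (min_le_left _ _)).trans ?_
    refine (ENNReal.ofReal_le_ofReal (q := (ε : ℝ)) ?_).trans_eq ENNReal.ofReal_coe_nnreal
    rw [div_le_iff₀ hc]
    exact min_le_right _ _
  have main' : ∀ᵐ x ∂μ, ∀ m : ℕ, ∀ᶠ n : ℕ in atTop,
      |birkhoffSum T f n x / n - ∫ x, f x ∂μ| ≤ 3 * (1 / ((m : ℝ) + 1)) :=
    ae_all_iff.2 fun m => main _ (by positivity)
  filter_upwards [main'] with x hx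
  rw [Metric.tendsto_nhds]
  intro ε hε
  obtain ⟨m, hm⟩ := exists_nat_one_div_lt (show 0 < ε / 3 by positivity)
  filter_upwards [hx m] with n hn
  rw [Real.dist_eq]
  linarith

end MaximalErgodic

/-! ### Cesàro averages along residue classes -/

section Residues

/-- `(N + d - 1 - r) / d` counts the indices below `N` congruent to `r` modulo `d`. Going from `N`
to `N + 1` raises this count for the class `N % d` only. -/
theorem sum_range_eq_sum_residues (a : ℕ → ℝ) {d : ℕ} (hd : 0 < d) (N : ℕ) :
    ∑ k ∈ Finset.range N, a k
      = ∑ r ∈ Finset.range d, ∑ k ∈ Finset.range ((N + d - 1 - r) / d), a (r + d * k) := by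
  induction N with
  | zero =>
    symm
    simp only [Finset.range_zero, Finset.sum_empty]
    refine Finset.sum_eq_zero fun r hr => ?_
    rw [Nat.div_eq_of_lt (by omega)]
    simp
  | succ N ih =>
    rw [Finset.sum_range_succ, ih]
    have hr0 : N % d ∈ Finset.range d := Finset.mem_range.2 (Nat.mod_lt _ hd)
    rw [← Finset.add_sum_erase _ _ hr0, ← Finset.add_sum_erase _ _ hr0]
    have hN := Nat.mod_add_div N d
    have h1 : (N + 1 + d - 1 - N % d) / d = N / d + 1 := by
      have : N + 1 + d - 1 - N % d = d * (N / d + 1) := by rw [Nat.mul_add]; omega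
      rw [this, Nat.mul_div_cancel_left _ hd]
    have h2 : (N + d - 1 - N % d) / d = N / d := by
      have : N + d - 1 - N % d = (d - 1) + d * (N / d) := by omega
      rw [this, Nat.add_mul_div_left _ _ hd, Nat.div_eq_of_lt (by omega), zero_add]
    have h3 : ∀ r ∈ (Finset.range d).erase (N % d),
        (N + 1 + d - 1 - r) / d = (N + d - 1 - r) / d := by
      intro r hr
      rw [Finset.mem_erase, Finset.mem_range] at hr
      have : N + 1 + d - 1 - r = (N + d - 1 - r) + 1 := by omega
      rw [this, Nat.succ_div_of_not_dvd]
      rintro ⟨q, hq⟩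
      apply hr.1
      have hq' : N + d = d * q + r := by omega
      have := congrArg (· % d) hq'
      simp only [Nat.add_mod_right, Nat.mul_add_mod, Nat.mod_eq_of_lt hr.2] at this
      exact this.symm
    rw [h1, h2, Finset.sum_range_succ, hN]
    have : ∑ r ∈ (Finset.range d).erase (N % d),
          ∑ k ∈ Finset.range ((N + 1 + d - 1 - r) / d), a (r + d * k)
        = ∑ r ∈ (Finset.range d).erase (N % d),
          ∑ k ∈ Finset.range ((N + d - 1 - r) / d), a (r + d * k) :=
      Finset.sum_congr rfl fun r hr => by rw [h3 r hr]
    rw [this]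
    ring

/-- If the averages along all residue classes mod `d` converge to `L`, so do the averages. -/
theorem tendsto_average_of_residues (a : ℕ → ℝ) {d : ℕ} (hd : 0 < d) {L : ℝ}
    (h : ∀ r < d, Tendsto (fun N : ℕ => (∑ k ∈ Finset.range N, a (r + d * k)) / N)
      atTop (𝓝 L)) :
    Tendsto (fun N : ℕ => (∑ k ∈ Finset.range N, a k) / N) atTop (𝓝 L) := by
  have hd' : (0 : ℝ) < d := by exact_mod_cast hd
  -- Each class has `N / d` members up to an error of at most `1`, hence asymptotic density `1 / d`.
  have hcount : ∀ r < d,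
      Tendsto (fun N : ℕ => (((N + d - 1 - r) / d : ℕ) : ℝ) / N) atTop (𝓝 (1 / d)) := by
    intro r hr
    have l1 : Tendsto (fun N : ℕ => (1 : ℝ) / d - 1 / N) atTop (𝓝 (1 / d)) := by
      simpa using (tendsto_const_nhds (x := (1 : ℝ) / d)).sub
        (tendsto_one_div_atTop_nhds_zero_nat (𝕜 := ℝ))
    have l2 : Tendsto (fun N : ℕ => (1 : ℝ) / d + 1 / N) atTop (𝓝 (1 / d)) := by
      simpa using (tendsto_const_nhds (x := (1 : ℝ) / d)).add
        (tendsto_one_div_atTop_nhds_zero_nat (𝕜 := ℝ))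
    refine tendsto_of_tendsto_of_tendsto_of_le_of_le' l1 l2 ?_ ?_
    · filter_upwards [eventually_gt_atTop 0] with N hN
      have hN' : (0 : ℝ) < N := by exact_mod_cast hN
      have hlow : (N : ℝ) ≤ d * (((N + d - 1 - r) / d : ℕ) : ℝ) + d := by
        have h1 := Nat.div_add_mod (N + d - 1 - r) d
        have h2 := Nat.mod_lt (N + d - 1 - r) hd
        have : N ≤ d * ((N + d - 1 - r) / d) + d := by omega
        exact_mod_cast this
      rw [div_sub_div _ _ hd'.ne' hN'.ne', div_le_div_iff₀ (by positivity) hN']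
      nlinarith
    · filter_upwards [eventually_gt_atTop 0] with N hN
      have hN' : (0 : ℝ) < N := by exact_mod_cast hN
      have hup : d * (((N + d - 1 - r) / d : ℕ) : ℝ) ≤ N + d := by
        have h1 := Nat.div_mul_le_self (N + d - 1 - r) d
        have : d * ((N + d - 1 - r) / d) ≤ N + d := by rw [mul_comm]; omega
        exact_mod_cast this
      rw [div_add_div _ _ hd'.ne' hN'.ne', div_le_div_iff₀ hN' (by positivity)]
      nlinarith
  have hatTop : ∀ r < d, Tendsto (fun N : ℕ => (N + d - 1 - r) / d) atTop atTop := by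
    intro r hr
    refine (Nat.tendsto_div_const_atTop hd.ne').comp ?_
    refine tendsto_atTop_mono (fun N => ?_) tendsto_id
    simp only [id]
    omega
  have hsum : Tendsto (fun N : ℕ => ∑ r ∈ Finset.range d,
      (∑ k ∈ Finset.range ((N + d - 1 - r) / d), a (r + d * k))
        / (((N + d - 1 - r) / d : ℕ) : ℝ) * ((((N + d - 1 - r) / d : ℕ) : ℝ) / N))
      atTop (𝓝 (∑ _r ∈ Finset.range d, L * (1 / d))) := by
    refine tendsto_finsetSum _ fun r hr => ?_
    rw [Finset.mem_range] at hr
    exact ((h r hr).comp (hatTop r hr)).mul (hcount r hr)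
  have hL : ∑ _r ∈ Finset.range d, L * (1 / (d : ℝ)) = L := by
    rw [Finset.sum_const, Finset.card_range, nsmul_eq_mul]
    field_simp
  rw [hL] at hsum
  refine hsum.congr fun N => ?_
  rw [sum_range_eq_sum_residues a hd, Finset.sum_div]
  refine Finset.sum_congr rfl fun r _ => ?_
  -- An empty class contributes zero on both sides, thanks to the convention `0 / 0 = 0`.
  by_cases hz : (((N + d - 1 - r) / d : ℕ) : ℝ) = 0
  · have : (N + d - 1 - r) / d = 0 := by exact_mod_cast hz
    simp [this]
  · field_simp

end Residues

/-! ### The ergodic theorem for Bernoulli shifts -/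

section BernoulliShift

variable {E : Type*}

/-- The shift by `s` of two-sided sequences. -/
def shift (s : ℤ) (z : ℤ → E) : ℤ → E := fun i => z (i + s)

theorem shift_shift (s t : ℤ) (z : ℤ → E) : shift s (shift t z) = shift (s + t) z := by
  funext i
  simp only [shift, add_assoc]

theorem shift_zero (z : ℤ → E) : shift 0 z = z := by
  funext i
  simp [shift]

theorem iterate_shift (s : ℤ) (k : ℕ) (z : ℤ → E) : (shift s)^[k] z = shift (k * s) z := by
  induction k generalizing z with
  | zero => simp [shift_zero]
  | succ k ih =>
    rw [Function.iterate_succ_apply, ih, shift_shift]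
    congr 1
    push_cast
    ring

variable [MeasurableSpace E]

theorem measurable_shift (s : ℤ) : Measurable (shift s : (ℤ → E) → ℤ → E) :=
  measurable_pi_lambda _ fun i => measurable_pi_apply (i + s)

theorem measurePreserving_shift (μ : Measure E) [IsProbabilityMeasure μ] (s : ℤ) :
    MeasurePreserving (shift s) (Measure.infinitePi fun _ : ℤ => μ)
      (Measure.infinitePi fun _ : ℤ => μ) :=
  ⟨measurable_shift s, Measure.map_infinitePi_infinitePi_of_inj (P := fun _ : ℤ => μ)
    (f := fun i : ℤ => i + s) (add_left_injective s)⟩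

/-- The σ-algebra of two-sided sequences generated by the coordinates in `I`. -/
abbrev coordSigma (E : Type*) [mE : MeasurableSpace E] (I : Set ℤ) : MeasurableSpace (ℤ → E) :=
  ⨆ i ∈ I, mE.comap fun z : ℤ → E => z i

theorem coordSigma_le (I : Set ℤ) : coordSigma E I ≤ MeasurableSpace.pi :=
  iSup₂_le fun i _ => (measurable_pi_apply i).comap_le

theorem coordSigma_mono {I J : Set ℤ} (h : I ⊆ J) : coordSigma E I ≤ coordSigma E J :=
  biSup_mono h

theorem indep_coordSigma (μ : Measure E) [IsProbabilityMeasure μ] {I J : Set ℤ}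
    (h : Disjoint I J) :
    Indep (coordSigma E I) (coordSigma E J) (Measure.infinitePi fun _ : ℤ => μ) := by
  have h0 : iIndepFun (fun (i : ℤ) (z : ℤ → E) => z i) (Measure.infinitePi fun _ : ℤ => μ) :=
    iIndepFun_infinitePi (P := fun _ : ℤ => μ) (X := fun _ (x : E) => x) fun _ => measurable_id
  exact indep_iSup_of_disjoint (fun i => (measurable_pi_apply i).comap_le) h0 h

theorem measurable_shift_coordSigma {I J : Set ℤ} {s : ℤ} (h : ∀ i ∈ I, i + s ∈ J) :
    Measurable[coordSigma E J, coordSigma E I] (shift s : (ℤ → E) → ℤ → E) := by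
  rw [measurable_iff_comap_le]
  simp only [coordSigma, MeasurableSpace.comap_iSup, MeasurableSpace.comap_comp]
  exact iSup₂_le fun i hi => le_iSup₂_of_le (i + s) (h i hi) le_rfl

/-- The filtration of the growing windows `[-n, n]`. -/
def windowFiltration (E : Type*) [MeasurableSpace E] :
    Filtration ℕ (MeasurableSpace.pi : MeasurableSpace (ℤ → E)) where
  seq n := coordSigma E (Set.Icc (-(n : ℤ)) n)
  mono' m n h := coordSigma_mono (Set.Icc_subset_Icc (by simpa using h) (by simpa using h))
  le' n := coordSigma_le _

/-- The coordinate `i` lies in the window of radius `|i|`. This makes conditional expectations on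
the windows converge to the function itself. -/
theorem iSup_windowFiltration :
    ⨆ n, windowFiltration E n = (MeasurableSpace.pi : MeasurableSpace (ℤ → E)) := by
  refine le_antisymm (iSup_le fun n => (windowFiltration E).le n) ?_
  refine iSup_le fun i => ?_
  refine le_iSup_of_le i.natAbs ?_
  exact le_iSup₂_of_le (f := fun (j : ℤ) (_ : j ∈ Set.Icc (-(i.natAbs : ℤ)) i.natAbs) =>
    MeasurableSpace.comap (fun z : ℤ → E => z j) _) i
    (Set.mem_Icc.2 (by omega)) le_rfl

/-- The strong law of large numbers along a shift for a function of finitely many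
coordinates. -/
theorem ae_tendsto_birkhoffSum_shift_of_window (μ : Measure E) [IsProbabilityMeasure μ] {s : ℤ}
    (hs : s ≠ 0) (n : ℕ) {g : (ℤ → E) → ℝ} (hg : Measurable[windowFiltration E n] g)
    (hgi : Integrable g (Measure.infinitePi fun _ : ℤ => μ)) :
    ∀ᵐ z ∂(Measure.infinitePi fun _ : ℤ => μ),
      Tendsto (fun N : ℕ => birkhoffSum (shift s) g N z / N) atTop
        (𝓝 (∫ z, g z ∂(Measure.infinitePi fun _ : ℤ => μ))) := by
  set P := Measure.infinitePi fun _ : ℤ => μ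
  have hgm : Measurable g := hg.mono ((windowFiltration E).le n) le_rfl
  -- A window `[-n, n]` has `2n + 1` sites. Translates of it by distinct multiples of `d * s` are
  -- disjoint because `|s| ≥ 1`, so sampling every `d`-th term gives independent variables.
  set d := 2 * n + 1
  have key : ∀ r : ℕ, ∀ᵐ z ∂P, Tendsto
      (fun N : ℕ => (∑ k ∈ Finset.range N, g (shift (((r + d * k : ℕ) : ℤ) * s) z)) / N) atTop
      (𝓝 (∫ z, g z ∂P)) := by
    intro r
    have hmp := fun j : ℤ => measurePreserving_shift μ j
    have hid : ∀ j : ℤ, IdentDistrib (fun z => g (shift j z)) g P P := by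
      intro j
      refine ⟨(hgm.comp (measurable_shift j)).aemeasurable, hgm.aemeasurable, ?_⟩
      have : Measure.map (fun z => g (shift j z)) P = Measure.map g (Measure.map (shift j) P) :=
        (Measure.map_map hgm (measurable_shift j)).symm
      rw [this, (hmp j).map_eq]
    -- The strong law in this form needs pairwise independence only, which is what disjointness of
    -- two windows supplies.
    have hlaw := strong_law_ae_real (μ := P)
      (fun k z => g (shift (((r + d * k : ℕ) : ℤ) * s) z))
      ((hid _).integrable_iff.2 hgi) ?_ (fun k => (hid _).trans (hid _).symm)
    · have e := (hid (((r + d * 0 : ℕ) : ℤ) * s)).integral_eq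
      rw [e] at hlaw
      exact hlaw
    · intro k l hkl
      set I : ℤ → Set ℤ := fun j => Set.Icc (j - n) (j + n)
      have hmeas : ∀ j : ℤ, Measurable[coordSigma E (I j)] fun z => g (shift j z) := by
        intro j
        refine hg.comp (measurable_shift_coordSigma fun i hi => ?_)
        rw [Set.mem_Icc] at hi ⊢
        omega
      have hdis : Disjoint (I (((r + d * k : ℕ) : ℤ) * s)) (I (((r + d * l : ℕ) : ℤ) * s)) := by
        rw [Set.disjoint_left]
        rintro i hi hi'
        rw [Set.mem_Icc] at hi hi'
        have h1 : |((r + d * k : ℕ) : ℤ) * s - ((r + d * l : ℕ) : ℤ) * s| ≤ 2 * n := by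
          rw [abs_le]; constructor <;> omega
        have h2 : ((r + d * k : ℕ) : ℤ) * s - ((r + d * l : ℕ) : ℤ) * s
            = d * (((k : ℤ) - l) * s) := by push_cast; ring
        rw [h2, abs_mul] at h1
        have h3 : 1 ≤ |((k : ℤ) - l) * s| :=
          Int.one_le_abs (mul_ne_zero (sub_ne_zero.2 (by exact_mod_cast hkl)) hs)
        have h4 : |(d : ℤ)| = 2 * n + 1 := by simp [d]; omega
        nlinarith
      exact indep_of_indep_of_le_right (indep_of_indep_of_le_left (indep_coordSigma μ hdis)
        (hmeas _).comap_le) (hmeas _).comap_le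
  filter_upwards [ae_all_iff.2 key] with z hz
  have := tendsto_average_of_residues (fun k => g (shift ((k : ℤ) * s) z))
    (d := d) (by omega) (fun r _ => hz r)
  simpa only [birkhoffSum, iterate_shift] using this

/-- The pointwise ergodic theorem for Bernoulli shifts. -/
theorem ae_tendsto_birkhoffSum_shift (μ : Measure E) [IsProbabilityMeasure μ] {s : ℤ}
    (hs : s ≠ 0) {f : (ℤ → E) → ℝ} (hfm : Measurable f)
    (hf : Integrable f (Measure.infinitePi fun _ : ℤ => μ)) :
    ∀ᵐ z ∂(Measure.infinitePi fun _ : ℤ => μ),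
      Tendsto (fun N : ℕ => (∑ k ∈ Finset.range N, f (shift (k * s) z)) / N) atTop
        (𝓝 (∫ z, f z ∂(Measure.infinitePi fun _ : ℤ => μ))) := by
  set P := Measure.infinitePi fun _ : ℤ => μ
  have := ae_tendsto_birkhoffSum_of_approx (measurePreserving_shift μ s) hfm hf ?_
  · simpa only [birkhoffSum, iterate_shift] using this
  intro δ hδ
  -- Lévy's upward theorem in `L¹` provides the approximation by functions of finitely many
  -- coordinates.
  have hconv := hf.tendsto_eLpNorm_condExp (ℱ := windowFiltration E)
    (by rw [iSup_windowFiltration]; exact hfm.stronglyMeasurable)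
  obtain ⟨n, hn⟩ := (hconv.eventually (gt_mem_nhds (ENNReal.ofReal_pos.2 hδ))).exists
  have hgm : Measurable[windowFiltration E n] (P[f | windowFiltration E n]) :=
    stronglyMeasurable_condExp.measurable
  refine ⟨P[f | windowFiltration E n], hgm.mono ((windowFiltration E).le n) le_rfl,
    integrable_condExp, ?_,
    ae_tendsto_birkhoffSum_shift_of_window μ hs n hgm integrable_condExp⟩
  have hi : Integrable (P[f | windowFiltration E n] - f) P := integrable_condExp.sub hf
  have e : ∫ x, |f x - (P[f | windowFiltration E n]) x| ∂P
      = (eLpNorm (P[f | windowFiltration E n] - f) 1 P).toReal := by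
    rw [eLpNorm_one_eq_lintegral_enorm, ← integral_norm_eq_lintegral_enorm hi.1]
    refine integral_congr_ae (Eventually.of_forall fun x => ?_)
    simp [Real.norm_eq_abs, abs_sub_comm]
  rw [e]
  exact ENNReal.toReal_le_of_le_ofReal hδ.le hn.le

end BernoulliShift

/-! ### Submultiplicative norms against matrix entries -/

section MatrixNorm

variable {p : ℕ} (ν : AlgebraNorm ℝ (Matrix (Fin p) (Fin p) ℝ))

/-- Every entry of a matrix is controlled by any submultiplicative norm. -/
theorem exists_abs_entry_le :
    ∃ C : ℝ, 0 ≤ C ∧ ∀ (M : Matrix (Fin p) (Fin p) ℝ) (i j : Fin p), |M i j| ≤ C * ν M := by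
  set u : Fin p → Fin p → ℝ := fun i j => ν (Matrix.single i j 1)
  have hu : ∀ i j, 0 < u i j := fun i j => by
    refine lt_of_le_of_ne (apply_nonneg ν _) fun h => ?_
    have h0 := eq_zero_of_map_eq_zero ν h.symm
    have := congrFun (congrFun h0 i) j
    simp at this
  have key : ∀ (M : Matrix (Fin p) (Fin p) ℝ) (i j : Fin p),
      |M i j| ≤ u i i * u j j / u i j * ν M := by
    intro M i j
    -- Sandwiching by matrix units isolates an entry: `E_ii M E_jj = M_ij E_ij`. Submultiplicativity
    -- then bounds `|M_ij|` by a multiple of `ν M`; summing the constants over all pairs makes the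
    -- bound uniform.
    have e : Matrix.single i i 1 * M * Matrix.single j j 1
        = M i j • Matrix.single i j (1 : ℝ) := by
      ext a b
      simp only [Matrix.mul_apply, Matrix.single_apply, Matrix.smul_apply, smul_eq_mul]
      by_cases ha : i = a <;> by_cases hb : j = b <;> simp [ha, hb]
    have h1 : |M i j| * u i j ≤ u i i * ν M * u j j := by
      calc |M i j| * u i j = ν (M i j • Matrix.single i j (1 : ℝ)) := by
            rw [map_smul_eq_mul, Real.norm_eq_abs]
        _ = ν (Matrix.single i i 1 * M * Matrix.single j j 1) := by rw [e]
        _ ≤ ν (Matrix.single i i 1 * M) * u j j := map_mul_le_mul ν _ _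
        _ ≤ u i i * ν M * u j j :=
            mul_le_mul_of_nonneg_right (map_mul_le_mul ν _ _) (hu j j).le
    have h2 : |M i j| ≤ u i i * ν M * u j j / u i j := (le_div_iff₀ (hu i j)).2 h1
    exact h2.trans_eq (by ring)
  refine ⟨∑ i, ∑ j, u i i * u j j / u i j, ?_, fun M i j => (key M i j).trans ?_⟩
  · exact Finset.sum_nonneg fun i _ => Finset.sum_nonneg fun j _ =>
      div_nonneg (mul_nonneg (hu _ _).le (hu _ _).le) (hu _ _).le
  · refine mul_le_mul_of_nonneg_right ?_ (apply_nonneg ν M)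
    have hnn : ∀ i j, 0 ≤ u i i * u j j / u i j := fun i j =>
      div_nonneg (mul_nonneg (hu _ _).le (hu _ _).le) (hu _ _).le
    exact (Finset.single_le_sum (f := fun j => u i i * u j j / u i j) (fun j _ => hnn i j)
      (Finset.mem_univ j)).trans
      (Finset.single_le_sum (f := fun i => ∑ j, u i i * u j j / u i j)
        (fun i _ => Finset.sum_nonneg fun j _ => hnn i j) (Finset.mem_univ i))

theorem algebraNorm_le_sum (M : Matrix (Fin p) (Fin p) ℝ) :
    ν M ≤ ∑ i, ∑ j, |M i j| * ν (Matrix.single i j 1) := by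
  have hsum : ∀ (s : Finset (Fin p)) (f : Fin p → Matrix (Fin p) (Fin p) ℝ),
      ν (∑ i ∈ s, f i) ≤ ∑ i ∈ s, ν (f i) := fun s f =>
    Finset.le_sum_of_subadditive ν (map_zero ν).le (map_add_le_add ν) s f
  conv_lhs => rw [Matrix.matrix_eq_sum_single M]
  refine (hsum _ _).trans (Finset.sum_le_sum fun i _ => (hsum _ _).trans
    (Finset.sum_le_sum fun j _ => ?_))
  have : Matrix.single i j (M i j) = M i j • Matrix.single i j (1 : ℝ) := by
    rw [Matrix.smul_single, smul_eq_mul, mul_one]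
  rw [this, map_smul_eq_mul, Real.norm_eq_abs]

/-- The reverse triangle inequality bounds the variation of `ν` by a weighted sum of entry
differences. Continuity serves to make norms of random matrices measurable. -/
theorem continuous_algebraNorm : Continuous fun M : Fin p → Fin p → ℝ => ν (Matrix.of M) := by
  rw [continuous_iff_continuousAt]
  intro N
  rw [ContinuousAt, tendsto_iff_dist_tendsto_zero]
  have hb : Tendsto (fun M : Fin p → Fin p → ℝ =>
      ∑ i, ∑ j, |M i j - N i j| * ν (Matrix.single i j 1)) (𝓝 N) (𝓝 0) := by
    have hc : Continuous fun M : Fin p → Fin p → ℝ =>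
        ∑ i, ∑ j, |M i j - N i j| * ν (Matrix.single i j 1) := by fun_prop
    simpa using hc.tendsto N
  refine squeeze_zero (fun _ => dist_nonneg) (fun M => ?_) hb
  rw [Real.dist_eq]
  refine (abs_sub_map_le_sub ν (Matrix.of M) (Matrix.of N)).trans ?_
  exact algebraNorm_le_sum ν _

theorem measurable_algebraNorm {Ω : Type*} [MeasurableSpace Ω]
    {A : Ω → Matrix (Fin p) (Fin p) ℝ} (hA : ∀ i j, Measurable fun ω => A ω i j) :
    Measurable fun ω => ν (A ω) := by
  have h : Measurable fun ω => (fun i j => A ω i j : Fin p → Fin p → ℝ) :=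
    measurable_pi_lambda _ fun i => measurable_pi_lambda _ fun j => hA i j
  exact (continuous_algebraNorm ν).measurable.comp h

end MatrixNorm

/-! ### The logarithm truncated from below -/

section TruncatedLog

/-- The positive part of `ln y`, with `ln 0 = -∞`. -/
noncomputable def extLogPos (y : ℝ) : ENNReal := (ENNReal.log (ENNReal.ofReal y)).toENNReal

/-- The negative part of `ln y`, with `ln 0 = -∞`. -/
noncomputable def extLogNeg (y : ℝ) : ENNReal := (-ENNReal.log (ENNReal.ofReal y)).toENNReal

/-- The logarithm truncated below at `-m`. -/
noncomputable def truncLog (m : ℕ) (y : ℝ) : ℝ :=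
  (extLogPos y).toReal - (min (extLogNeg y) m).toReal

theorem measurable_extLogPos : Measurable extLogPos :=
  (ENNReal.measurable_log.comp ENNReal.measurable_ofReal).ereal_toENNReal

theorem measurable_extLogNeg : Measurable extLogNeg := by
  have : Measurable fun x : EReal => -x := continuous_neg.measurable
  exact (this.comp (ENNReal.measurable_log.comp ENNReal.measurable_ofReal)).ereal_toENNReal

theorem measurable_truncLog (m : ℕ) : Measurable (truncLog m) :=
  measurable_extLogPos.ennreal_toReal.sub
    (measurable_extLogNeg.min measurable_const).ennreal_toReal

/-- Truncating the negative part can only increase the logarithm; at `y = 0` the right side is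
merely positive. -/
theorem le_exp_truncLog (m : ℕ) {y : ℝ} (hy : 0 ≤ y) : y ≤ exp (truncLog m y) := by
  rcases hy.eq_or_lt with rfl | hy
  · exact (exp_pos _).le
  refine (log_le_iff_le_exp hy).1 ?_
  have h1 : extLogPos y = ENNReal.ofReal (log y) := by
    rw [extLogPos, ENNReal.log_ofReal_of_pos hy, EReal.real_coe_toENNReal]
  have h2 : extLogNeg y = ENNReal.ofReal (-log y) := by
    rw [extLogNeg, ENNReal.log_ofReal_of_pos hy, ← EReal.coe_neg, EReal.real_coe_toENNReal]
  have h3 : (min (extLogNeg y) m).toReal ≤ max (-log y) 0 := by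
    rw [h2, ← ENNReal.toReal_ofReal']
    exact ENNReal.toReal_mono ENNReal.ofReal_ne_top (min_le_left _ _)
  rw [truncLog, h1, ENNReal.toReal_ofReal']
  rcases le_total 0 (log y) with h | h
  · rw [max_eq_right (by linarith)] at h3
    linarith [le_max_left (log y) 0]
  · rw [max_eq_left (by linarith)] at h3
    linarith [le_max_right (log y) 0]

/-- The strict inequality forces `E[ln⁺ Y] < ∞`, and by monotone convergence it survives when `ln⁻
Y` is cut at a large enough `m`. The result is an integrable real function of negative mean even
when `E[ln Y] = -∞`, so the ergodic theorem for integrable functions suffices. -/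
theorem exists_integral_truncLog_neg {Ω : Type*} [MeasurableSpace Ω] {P : Measure Ω}
    [IsProbabilityMeasure P] {Y : Ω → ℝ} (hY : Measurable Y) (h : RCAR.ExpLogNeg P Y) :
    ∃ m : ℕ, Integrable (fun ω => truncLog m (Y ω)) P ∧ ∫ ω, truncLog m (Y ω) ∂P < 0 := by
  have hpos : Measurable fun ω => extLogPos (Y ω) := measurable_extLogPos.comp hY
  have hneg : Measurable fun ω => extLogNeg (Y ω) := measurable_extLogNeg.comp hY
  have hmin : ∀ m : ℕ, Measurable fun ω => min (extLogNeg (Y ω)) (m : ENNReal) := fun m =>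
    hneg.min measurable_const
  have hlt : ∫⁻ ω, extLogPos (Y ω) ∂P < ∫⁻ ω, extLogNeg (Y ω) ∂P := h
  have hsup : ∫⁻ ω, extLogNeg (Y ω) ∂P = ⨆ m : ℕ, ∫⁻ ω, min (extLogNeg (Y ω)) m ∂P := by
    rw [← lintegral_iSup hmin
      (fun m n hmn ω => min_le_min le_rfl (by exact_mod_cast hmn))]
    refine lintegral_congr fun ω => ?_
    refine le_antisymm ?_ (iSup_le fun m => min_le_left _ _)
    refine le_of_forall_lt fun a ha => ?_
    obtain ⟨m, hm⟩ := ENNReal.exists_nat_gt (ne_top_of_lt ha)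
    exact lt_iSup_iff.2 ⟨m, lt_min ha hm⟩
  rw [hsup] at hlt
  obtain ⟨m, hm⟩ := lt_iSup_iff.1 hlt
  have hfin1 : ∫⁻ ω, extLogPos (Y ω) ∂P ≠ ⊤ := ne_top_of_lt hlt
  have hfin2 : ∫⁻ ω, min (extLogNeg (Y ω)) m ∂P ≠ ⊤ := by
    refine ne_top_of_le_ne_top (b := (m : ENNReal)) (ENNReal.natCast_ne_top m) ?_
    refine (lintegral_mono fun ω => min_le_right _ _).trans_eq ?_
    simp
  have i1 : Integrable (fun ω => (extLogPos (Y ω)).toReal) P :=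
    integrable_toReal_of_lintegral_ne_top hpos.aemeasurable hfin1
  have i2 : Integrable (fun ω => (min (extLogNeg (Y ω)) m).toReal) P :=
    integrable_toReal_of_lintegral_ne_top (hmin m).aemeasurable hfin2
  refine ⟨m, i1.sub i2, ?_⟩
  have e : ∫ ω, truncLog m (Y ω) ∂P = ∫ ω, (extLogPos (Y ω)).toReal ∂P
      - ∫ ω, (min (extLogNeg (Y ω)) m).toReal ∂P := integral_sub i1 i2
  rw [e, integral_toReal hpos.aemeasurable (ae_lt_top hpos hfin1),
    integral_toReal (hmin m).aemeasurable
      (ae_lt_top (hmin m) hfin2), sub_neg]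
  exact (ENNReal.toReal_lt_toReal hfin1 hfin2).2 hm

end TruncatedLog

/-! ### Vector form of the recursion and its iterates -/

namespace RCAR

section VectorForm

variable {Ω : Type*} {p : ℕ}

theorem coeffMatrix_apply (θ α : Fin p → ℝ) (η : Fin p → ℤ → Ω → ℝ) (t : ℤ) (ω : Ω)
    (i j : Fin p) :
    coeffMatrix θ α η t ω i j = if (i : ℕ) = 0 then θ j + α j * η j (t - 1) ω + η j t ω
      else if (i : ℕ) = (j : ℕ) + 1 then 1 else 0 := by
  simp only [coeffMatrix, companion, firstRow, Matrix.add_apply, Matrix.mul_diagonal,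
    Matrix.of_apply]
  split_ifs <;> ring

/-- The vector form of the recursion. -/
theorem Phi_eq_mulVec_add {θ α : Fin p → ℝ} {ε : ℤ → Ω → ℝ} {η : Fin p → ℤ → Ω → ℝ}
    {X : ℤ → Ω → ℝ} {t : ℤ} {ω : Ω}
    (h : X t ω = ∑ k : Fin p, (θ k + α k * η k (t - 1) ω + η k t ω) * X (t - ((k : ℤ) + 1)) ω
      + ε t ω) :
    Phi p X t ω = coeffMatrix θ α η t ω *ᵥ Phi p X (t - 1) ω
      + fun i : Fin p => if (i : ℕ) = 0 then ε t ω else 0 := by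
  funext i
  simp only [Pi.add_apply, Matrix.mulVec, dotProduct, coeffMatrix_apply, Phi]
  by_cases hi : (i : ℕ) = 0
  · simp only [hi, if_true, Nat.cast_zero, sub_zero, h]
    congr 1
    refine Finset.sum_congr rfl fun k _ => ?_
    rw [show t - 1 - (k : ℤ) = t - ((k : ℤ) + 1) by ring]
  · simp only [hi, if_false, add_zero, ite_mul, one_mul, zero_mul]
    have hlt : (i : ℕ) - 1 < p := by omega
    rw [Finset.sum_eq_single (⟨(i : ℕ) - 1, hlt⟩ : Fin p)]
    · rw [if_pos (by simp only; omega)]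
      congr 1
      simp only
      omega
    · intro b _ hb
      rw [if_neg]
      intro hib
      apply hb
      ext
      simp only
      omega
    · simp

/-- The Picard iterates of the vector recursion, started at zero `m` steps in the past. -/
noncomputable def vecIter (θ α : Fin p → ℝ) (ε : ℤ → Ω → ℝ) (η : Fin p → ℤ → Ω → ℝ) :
    ℕ → ℤ → Ω → Fin p → ℝ
  | 0, _, _ => 0
  | m + 1, t, ω => coeffMatrix θ α η t ω *ᵥ vecIter θ α ε η m (t - 1) ω
      + fun i : Fin p => if (i : ℕ) = 0 then ε t ω else 0

/-- The product of the coefficient matrices at the times `t, t - 1, …, t - m + 1`. -/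
noncomputable def coeffProd (θ α : Fin p → ℝ) (η : Fin p → ℤ → Ω → ℝ) :
    ℕ → ℤ → Ω → Matrix (Fin p) (Fin p) ℝ
  | 0, _, _ => 1
  | m + 1, t, ω => coeffMatrix θ α η t ω * coeffProd θ α η m (t - 1) ω

/-- The inhomogeneous terms cancel, so the difference obeys the homogeneous recursion. -/
theorem Phi_sub_vecIter {θ α : Fin p → ℝ} {ε : ℤ → Ω → ℝ} {η : Fin p → ℤ → Ω → ℝ}
    {X : ℤ → Ω → ℝ} {ω : Ω}
    (h : ∀ t, X t ω = ∑ k : Fin p,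
      (θ k + α k * η k (t - 1) ω + η k t ω) * X (t - ((k : ℤ) + 1)) ω + ε t ω)
    (m : ℕ) (t : ℤ) :
    Phi p X t ω - vecIter θ α ε η m t ω = coeffProd θ α η m t ω *ᵥ Phi p X (t - m) ω := by
  induction m generalizing t with
  | zero => simp [vecIter, coeffProd]
  | succ m ih =>
    have e : t - ((m + 1 : ℕ) : ℤ) = t - 1 - m := by push_cast; ring
    rw [Phi_eq_mulVec_add (h t), vecIter, coeffProd, ← Matrix.mulVec_mulVec, e, ← ih,
      Matrix.mulVec_sub]
    abel

/-- The factor `ν 1` appears because the norm is not assumed to give the identity norm one. -/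
theorem algebraNorm_coeffProd_le (ν : AlgebraNorm ℝ (Matrix (Fin p) (Fin p) ℝ))
    (θ α : Fin p → ℝ) (η : Fin p → ℤ → Ω → ℝ) (m : ℕ) (t : ℤ) (ω : Ω) :
    ν (coeffProd θ α η m t ω)
      ≤ ν 1 * ∏ j ∈ Finset.range m, ν (coeffMatrix θ α η (t - j) ω) := by
  induction m generalizing t with
  | zero => simp [coeffProd]
  | succ m ih =>
    rw [coeffProd, Finset.prod_range_succ']
    refine (map_mul_le_mul ν _ _).trans ?_
    refine (mul_le_mul_of_nonneg_left (ih (t - 1)) (apply_nonneg ν _)).trans_eq ?_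
    have : ∀ j : ℕ, t - 1 - (j : ℤ) = t - ((j + 1 : ℕ) : ℤ) := fun j => by push_cast; ring
    simp only [this, Nat.cast_zero, sub_zero]
    ring

end VectorForm

/-! ### Transfer to the canonical space of noise sequences -/

section Canonical

variable {p : ℕ}

/-- The two-sided sequence of noise vectors. -/
def noisePath {Ω : Type*} (ε : ℤ → Ω → ℝ) (η : Fin p → ℤ → Ω → ℝ) (ω : Ω) :
    ℤ → ℝ × (Fin p → ℝ) :=
  fun t => (ε t ω, fun k => η k t ω)

/-- The coordinate process of the first components of the noise vectors. -/
def coordEps (t : ℤ) (z : ℤ → ℝ × (Fin p → ℝ)) : ℝ := (z t).1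

/-- The coordinate processes of the remaining components of the noise vectors. -/
def coordEta (k : Fin p) (t : ℤ) (z : ℤ → ℝ × (Fin p → ℝ)) : ℝ := (z t).2 k

theorem coeffMatrix_noisePath {Ω : Type*} (θ α : Fin p → ℝ) (ε : ℤ → Ω → ℝ)
    (η : Fin p → ℤ → Ω → ℝ) (t : ℤ) (ω : Ω) :
    coeffMatrix θ α coordEta t (noisePath ε η ω) = coeffMatrix θ α η t ω := rfl

theorem vecIter_noisePath {Ω : Type*} (θ α : Fin p → ℝ) (ε : ℤ → Ω → ℝ)
    (η : Fin p → ℤ → Ω → ℝ) (m : ℕ) (t : ℤ) (ω : Ω) :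
    vecIter θ α coordEps coordEta m t (noisePath ε η ω) = vecIter θ α ε η m t ω := by
  induction m generalizing t with
  | zero => rfl
  | succ m ih =>
    rw [vecIter, vecIter, ih]
    rfl

theorem coeffMatrix_shift (θ α : Fin p → ℝ) (t s : ℤ) (z : ℤ → ℝ × (Fin p → ℝ)) :
    coeffMatrix θ α coordEta t (shift s z) = coeffMatrix θ α coordEta (t + s) z := by
  ext i j
  simp only [coeffMatrix_apply, coordEta, shift]
  rw [show t - 1 + s = t + s - 1 by ring]

theorem vecIter_shift (θ α : Fin p → ℝ) (m : ℕ) (t s : ℤ) (z : ℤ → ℝ × (Fin p → ℝ)) :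
    vecIter θ α coordEps coordEta m t (shift s z)
      = vecIter θ α coordEps coordEta m (t + s) z := by
  induction m generalizing t with
  | zero => rfl
  | succ m ih =>
    rw [vecIter, vecIter, ih, coeffMatrix_shift, show t - 1 + s = t + s - 1 by ring]
    rfl

theorem measurable_coord {I : Set ℤ} {i : ℤ} (hi : i ∈ I) :
    Measurable[coordSigma (ℝ × (Fin p → ℝ)) I] fun z : ℤ → ℝ × (Fin p → ℝ) => z i :=
  (comap_measurable _).mono (le_iSup₂_of_le (f := fun (j : ℤ) (_ : j ∈ I) =>
    MeasurableSpace.comap (fun z : ℤ → ℝ × (Fin p → ℝ) => z j) _) i hi le_rfl) le_rfl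

theorem measurable_coordEta {I : Set ℤ} {i : ℤ} (hi : i ∈ I) (k : Fin p) :
    Measurable[coordSigma (ℝ × (Fin p → ℝ)) I] (coordEta k i) :=
  ((measurable_pi_apply k).comp measurable_snd).comp (measurable_coord hi)

theorem measurable_coordEps {I : Set ℤ} {i : ℤ} (hi : i ∈ I) :
    Measurable[coordSigma (ℝ × (Fin p → ℝ)) I] (coordEps (p := p) i) :=
  measurable_fst.comp (measurable_coord hi)

theorem measurable_coeffMatrix_apply (θ α : Fin p → ℝ) {s t : ℤ} (hst : s ≤ t) (i j : Fin p) :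
    Measurable[coordSigma (ℝ × (Fin p → ℝ)) (Set.Iic t)]
      fun z => coeffMatrix θ α coordEta s z i j := by
  simp only [coeffMatrix_apply]
  split_ifs
  · have h1 := measurable_coordEta (p := p) (I := Set.Iic t) (i := s - 1)
      (Set.mem_Iic.2 (by omega)) j
    have h2 := measurable_coordEta (p := p) (I := Set.Iic t) (i := s) hst j
    exact (measurable_const.add (measurable_const.mul h1)).add h2
  · exact measurable_const
  · exact measurable_const

theorem measurable_vecIter (θ α : Fin p → ℝ) (m : ℕ) {s t : ℤ} (hst : s ≤ t) (i : Fin p) :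
    Measurable[coordSigma (ℝ × (Fin p → ℝ)) (Set.Iic t)]
      fun z => vecIter θ α coordEps coordEta m s z i := by
  induction m generalizing s i with
  | zero => exact measurable_const
  | succ m ih =>
    simp only [vecIter, Pi.add_apply, Matrix.mulVec, dotProduct]
    refine Measurable.add (Finset.measurable_sum _ fun j _ => ?_) ?_
    · exact (measurable_coeffMatrix_apply θ α hst i j).mul (ih (by omega) j)
    · split_ifs
      · exact measurable_coordEps hst
      · exact measurable_const

variable {Ω : Type*} [MeasurableSpace Ω] {P : Measure Ω} {ε : ℤ → Ω → ℝ}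
  {η : Fin p → ℤ → Ω → ℝ}

/-- The law of a noise vector. -/
noncomputable def noiseLaw (P : Measure Ω) (ε : ℤ → Ω → ℝ) (η : Fin p → ℤ → Ω → ℝ) :
    Measure (ℝ × (Fin p → ℝ)) :=
  P.map fun ω => (ε 0 ω, fun k => η k 0 ω)

theorem IsNoise.measurable_vec (h : IsNoise P ε η) (t : ℤ) :
    Measurable fun ω => (ε t ω, fun k => η k t ω) :=
  (h.measurable_eps t).prodMk (measurable_pi_lambda _ fun k => h.measurable_eta k t)

theorem IsNoise.isProbabilityMeasure_noiseLaw [IsProbabilityMeasure P] (h : IsNoise P ε η) :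
    IsProbabilityMeasure (noiseLaw P ε η) :=
  Measure.isProbabilityMeasure_map (h.measurable_vec 0).aemeasurable

/-- Independence together with a common law says exactly that the noise path has a product law, so
results on the Bernoulli shift pull back to `Ω`. -/
theorem IsNoise.measurePreserving_noisePath [IsProbabilityMeasure P] (h : IsNoise P ε η) :
    MeasurePreserving (noisePath ε η) P
      (Measure.infinitePi fun _ : ℤ => noiseLaw P ε η) := by
  refine ⟨measurable_pi_lambda _ fun t => h.measurable_vec t, ?_⟩
  have := h.indep.map_fun_eq_infinitePi_map h.measurable_vec
  have e : ∀ t : ℤ, P.map (fun ω => (ε t ω, fun k => η k t ω)) = noiseLaw P ε η :=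
    fun t => (h.identDistrib t).map_eq
  simp only [e] at this
  exact this

/-- The ergodic theorem along the noise sequence. -/
theorem IsNoise.ae_tendsto_average [IsProbabilityMeasure P] (h : IsNoise P ε η) {s : ℤ}
    (hs : s ≠ 0) {f : (ℤ → ℝ × (Fin p → ℝ)) → ℝ} (hfm : Measurable f)
    (hf : Integrable (fun ω => f (noisePath ε η ω)) P) :
    ∀ᵐ ω ∂P, Tendsto (fun N : ℕ =>
        (∑ k ∈ Finset.range N, f (shift (k * s) (noisePath ε η ω))) / N) atTop
      (𝓝 (∫ ω, f (noisePath ε η ω) ∂P)) := by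
  have hmp := h.measurePreserving_noisePath
  have := h.isProbabilityMeasure_noiseLaw
  have hf' := (hmp.integrable_comp hfm.aestronglyMeasurable).1 hf
  have key := hmp.quasiMeasurePreserving.ae (ae_tendsto_birkhoffSum_shift _ hs hfm hf')
  have e : ∫ ω, f (noisePath ε η ω) ∂P
      = ∫ z, f z ∂(Measure.infinitePi fun _ : ℤ => noiseLaw P ε η) := by
    rw [← hmp.map_eq, integral_map hmp.measurable.aemeasurable hfm.aestronglyMeasurable]
  rw [e]
  exact key

theorem IsNoise.integrable_shift_iff [IsProbabilityMeasure P] (h : IsNoise P ε η) (s : ℤ)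
    {f : (ℤ → ℝ × (Fin p → ℝ)) → ℝ} (hfm : Measurable f) :
    Integrable (fun ω => f (shift s (noisePath ε η ω))) P
      ↔ Integrable (fun ω => f (noisePath ε η ω)) P := by
  have hmp := h.measurePreserving_noisePath
  have := h.isProbabilityMeasure_noiseLaw
  have hs := (measurePreserving_shift (noiseLaw P ε η) s).comp hmp
  exact (hs.integrable_comp hfm.aestronglyMeasurable).trans
    (hmp.integrable_comp hfm.aestronglyMeasurable).symm

theorem IsNoise.integral_shift [IsProbabilityMeasure P] (h : IsNoise P ε η) (s : ℤ)
    {f : (ℤ → ℝ × (Fin p → ℝ)) → ℝ} (hfm : Measurable f) :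
    ∫ ω, f (shift s (noisePath ε η ω)) ∂P = ∫ ω, f (noisePath ε η ω) ∂P := by
  have hmp := h.measurePreserving_noisePath
  have := h.isProbabilityMeasure_noiseLaw
  have hs := (measurePreserving_shift (noiseLaw P ε η) s).comp hmp
  have e1 := integral_map hs.measurable.aemeasurable (f := f) (μ := P) hfm.aestronglyMeasurable
  have e2 := integral_map hmp.measurable.aemeasurable (f := f) (μ := P) hfm.aestronglyMeasurable
  rw [hs.map_eq] at e1
  rw [hmp.map_eq] at e2
  exact e1.symm.trans e2

end Canonical

end RCAR

/-! ### Causality of the stationary solution -/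

namespace RCAR

section Causality

variable {Ω : Type*} [MeasurableSpace Ω] {P : Measure Ω} {p : ℕ}
  {θ α : Fin p → ℝ} {ε : ℤ → Ω → ℝ} {η : Fin p → ℤ → Ω → ℝ} {X : ℤ → Ω → ℝ}

theorem IsRCAR.identDistrib_mul (h : IsRCAR P θ α ε η X) (a b s : ℤ) :
    IdentDistrib (fun ω => X (a + s) ω * X (b + s) ω) (fun ω => X a ω * X b ω) P P :=
  (h.stationary s).comp ((measurable_pi_apply a).mul (measurable_pi_apply b))

theorem IsRCAR.memLp (hp : 1 ≤ p) (h : IsRCAR P θ α ε η X) (hm : FiniteSecondMoments P η X)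
    (t : ℤ) : MemLp (X t) 2 P := by
  rw [memLp_two_iff_integrable_sq (h.measurable t).aestronglyMeasurable]
  simpa using hm 0 (by norm_num) ⟨0, hp⟩ t

theorem IsRCAR.integrable_mul (hp : 1 ≤ p) (h : IsRCAR P θ α ε η X)
    (hm : FiniteSecondMoments P η X) (s t : ℤ) : Integrable (fun ω => X s ω * X t ω) P :=
  (h.memLp hp hm s).integrable_mul (h.memLp hp hm t)

/-- The second moments of `e^{-cm} X_{t-m}` form a geometric series by stationarity. Hence the sum
of the squares has finite expectation, is almost surely finite, and its terms tend to zero. -/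
theorem IsRCAR.ae_tendsto_exp_mul (hp : 1 ≤ p) (h : IsRCAR P θ α ε η X)
    (hm : FiniteSecondMoments P η X) {c : ℝ} (hc : 0 < c) (t : ℤ) :
    ∀ᵐ ω ∂P, Tendsto (fun m : ℕ => exp (-(c * m)) * |X (t - m) ω|) atTop (𝓝 0) := by
  have hmeas : ∀ m : ℕ, Measurable fun ω => ENNReal.ofReal ((exp (-(c * m)) * |X (t - m) ω|) ^ 2) :=
    fun m => ((((h.measurable (t - m)).abs).const_mul _).pow_const 2).ennreal_ofReal
  have hval : ∀ m : ℕ, ∫⁻ ω, ENNReal.ofReal ((exp (-(c * m)) * |X (t - m) ω|) ^ 2) ∂P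
      = ENNReal.ofReal (exp (-(2 * c)) ^ m * ∫ ω, X 0 ω * X 0 ω ∂P) := by
    intro m
    have e : ∀ ω, (exp (-(c * m)) * |X (t - m) ω|) ^ 2
        = exp (-(2 * c)) ^ m * (X (0 + (t - m)) ω * X (0 + (t - m)) ω) := by
      intro ω
      rw [mul_pow, sq_abs, ← Real.exp_nat_mul, ← Real.exp_nat_mul, zero_add, sq (X _ _)]
      congr 2
      push_cast
      ring
    simp only [e]
    rw [← ofReal_integral_eq_lintegral_ofReal, integral_const_mul,
      (h.identDistrib_mul 0 0 (t - m)).integral_eq]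
    · exact (((h.identDistrib_mul 0 0 (t - m)).integrable_iff).2
        (h.integrable_mul hp hm 0 0)).const_mul _
    · exact Eventually.of_forall fun ω => mul_nonneg (by positivity) (mul_self_nonneg _)
  have hfin : ∫⁻ ω, ∑' m : ℕ, ENNReal.ofReal ((exp (-(c * m)) * |X (t - m) ω|) ^ 2) ∂P ≠ ⊤ := by
    rw [lintegral_tsum fun m => (hmeas m).aemeasurable]
    simp only [hval]
    have hs : Summable fun m : ℕ => exp (-(2 * c)) ^ m * ∫ ω, X 0 ω * X 0 ω ∂P :=
      (summable_geometric_of_lt_one (exp_pos _).le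
        (by rw [Real.exp_lt_one_iff]; linarith)).mul_right _
    have hnn : 0 ≤ ∫ ω, X 0 ω * X 0 ω ∂P := integral_nonneg fun ω => mul_self_nonneg _
    rw [← ENNReal.ofReal_tsum_of_nonneg (fun m => mul_nonneg (by positivity) hnn) hs]
    exact ENNReal.ofReal_ne_top
  filter_upwards [ae_lt_top (Measurable.tsum hmeas) hfin] with ω hω
  have h0 := ENNReal.tendsto_atTop_zero_of_tsum_ne_top hω.ne
  have h1 : Tendsto (fun m : ℕ => (exp (-(c * m)) * |X (t - m) ω|) ^ 2) atTop (𝓝 0) := by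
    have := (ENNReal.tendsto_toReal ENNReal.zero_ne_top).comp h0
    simpa [Function.comp_def, ENNReal.toReal_ofReal, sq_nonneg] using this
  have h2 := h1.sqrt
  simpa [Real.sqrt_sq, mul_nonneg, (exp_pos _).le] using h2

/-- `W` is almost surely a function of the noises up to time `t`. -/
def PastMeasurable (P : Measure Ω) (ε : ℤ → Ω → ℝ) (η : Fin p → ℤ → Ω → ℝ) (t : ℤ)
    (W : Ω → ℝ) : Prop :=
  ∃ w : (ℤ → ℝ × (Fin p → ℝ)) → ℝ, Measurable[coordSigma _ (Set.Iic t)] w ∧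
    W =ᵐ[P] fun ω => w (noisePath ε η ω)

theorem PastMeasurable.mul {t : ℤ} {V W : Ω → ℝ} (hV : PastMeasurable P ε η t V)
    (hW : PastMeasurable P ε η t W) : PastMeasurable P ε η t fun ω => V ω * W ω := by
  obtain ⟨v, hv, hVv⟩ := hV
  obtain ⟨w, hw, hWw⟩ := hW
  exact ⟨fun z => v z * w z, hv.mul hw, hVv.mul hWw⟩

theorem pastMeasurable_eta {s t : ℤ} (hst : s ≤ t) (k : Fin p) :
    PastMeasurable P ε η t (η k s) :=
  ⟨coordEta k s, measurable_coordEta (i := s) hst k, EventuallyEq.rfl⟩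

variable [IsProbabilityMeasure P]

/-- Under the stability condition, the products of the norms of the coefficient matrices decay
exponentially fast, almost surely. -/
theorem exists_prod_norm_le_exp (h : IsNoise P ε η)
    {ν : AlgebraNorm ℝ (Matrix (Fin p) (Fin p) ℝ)}
    (hν : ExpLogNeg P fun ω => ν (coeffMatrix θ α η 1 ω)) :
    ∃ c : ℝ, 0 < c ∧ ∀ t : ℤ, ∀ᵐ ω ∂P, ∀ᶠ m : ℕ in atTop,
      ∏ j ∈ Finset.range m, ν (coeffMatrix θ α η (t - j) ω) ≤ exp (-(c * m)) := by
  have hmeas : Measurable fun z => ν (coeffMatrix θ α (coordEta (p := p)) 0 z) :=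
    measurable_algebraNorm ν fun i j =>
      (measurable_coeffMatrix_apply θ α (le_refl 0) i j).mono (coordSigma_le _) le_rfl
  have hshift : ∀ (t : ℤ) (ω : Ω),
      coeffMatrix θ α coordEta 0 (shift t (noisePath ε η ω)) = coeffMatrix θ α η t ω := by
    intro t ω
    rw [coeffMatrix_shift, zero_add, coeffMatrix_noisePath]
  have hY : Measurable fun ω => ν (coeffMatrix θ α η 1 ω) := by
    have := hmeas.comp ((measurable_shift 1).comp h.measurePreserving_noisePath.measurable)
    simpa only [Function.comp_def, hshift] using this
  obtain ⟨M, hM1, hM2⟩ := exists_integral_truncLog_neg hY hν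
  set u : (ℤ → ℝ × (Fin p → ℝ)) → ℝ := fun z => truncLog M (ν (coeffMatrix θ α coordEta 0 z))
  have hu : Measurable u := (measurable_truncLog M).comp hmeas
  have hut : ∀ t ω, u (shift t (noisePath ε η ω)) = truncLog M (ν (coeffMatrix θ α η t ω)) :=
    fun t ω => by simp only [u, hshift]
  have hi : Integrable (fun ω => u (noisePath ε η ω)) P := by
    rw [← h.integrable_shift_iff 1 hu]
    simpa only [hut] using hM1
  have hneg : ∫ ω, u (noisePath ε η ω) ∂P < 0 := by
    rw [← h.integral_shift 1 hu]
    simpa only [hut] using hM2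
  set I := ∫ ω, u (noisePath ε η ω) ∂P
  -- Half of the exponent `-I` is given up so that the averages, which converge to `I`, are
  -- eventually below `I / 2 < 0`. The shift by `-1` runs through the factors backwards in time.
  refine ⟨-I / 2, by linarith, fun t => ?_⟩
  have herg := h.ae_tendsto_average (s := -1) (by norm_num) (hu.comp (measurable_shift t))
    ((h.integrable_shift_iff t hu).2 hi)
  filter_upwards [herg] with ω hω
  have e : ∫ ω, (u ∘ shift t) (noisePath ε η ω) ∂P = I := h.integral_shift t hu
  rw [e] at hω
  filter_upwards [hω.eventually (gt_mem_nhds (show I < I / 2 by linarith)),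
    eventually_gt_atTop 0] with m hm hm0
  have hm0' : (0 : ℝ) < m := by exact_mod_cast hm0
  rw [div_lt_iff₀ hm0'] at hm
  have hb : ∏ j ∈ Finset.range m, ν (coeffMatrix θ α η (t - j) ω)
      ≤ ∏ j ∈ Finset.range m, exp ((u ∘ shift t) (shift ((j : ℤ) * -1) (noisePath ε η ω))) := by
    refine Finset.prod_le_prod (fun _ _ => apply_nonneg ν _) fun j _ => ?_
    have := le_exp_truncLog M (apply_nonneg ν (coeffMatrix θ α η (t - j) ω))
    rw [Function.comp_apply, shift_shift, hut, show t + (j : ℤ) * -1 = t - j by ring]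
    exact this
  refine hb.trans ?_
  rw [← Real.exp_sum]
  refine exp_le_exp.2 ?_
  linarith

/-- A square-integrable stationary solution is the almost sure limit of the Picard iterates. -/
theorem IsRCAR.ae_tendsto_vecIter (hp : 1 ≤ p) (h : IsRCAR P θ α ε η X)
    (hm : FiniteSecondMoments P η X) (t : ℤ) :
    ∀ᵐ ω ∂P, Tendsto (fun m : ℕ => vecIter θ α ε η m t ω ⟨0, hp⟩) atTop (𝓝 (X t ω)) := by
  obtain ⟨ν, hν⟩ := h.stable.exp_log_norm_neg
  obtain ⟨c, hc, hprod⟩ := exists_prod_norm_le_exp h.noise hν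
  obtain ⟨C, hC, hentry⟩ := exists_abs_entry_le ν
  filter_upwards [ae_all_iff.2 h.recursion, hprod t,
    ae_all_iff.2 fun j : Fin p => h.ae_tendsto_exp_mul hp hm hc (t - (j : ℤ))]
    with ω hrec hω hX
  rw [tendsto_iff_dist_tendsto_zero]
  have hlim : Tendsto (fun m : ℕ => ∑ j : Fin p,
      C * ν 1 * (exp (-(c * m)) * |X (t - (j : ℤ) - m) ω|)) atTop (𝓝 0) := by
    simpa using tendsto_finsetSum Finset.univ fun j _ => (hX j).const_mul (C * ν 1)
  refine squeeze_zero' (Eventually.of_forall fun _ => dist_nonneg) ?_ hlim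
  filter_upwards [hω] with m hmω
  have e : X t ω - vecIter θ α ε η m t ω ⟨0, hp⟩
      = (coeffProd θ α η m t ω *ᵥ Phi p X (t - m) ω) ⟨0, hp⟩ := by
    rw [← Phi_sub_vecIter hrec]
    simp [Phi]
  rw [dist_comm, Real.dist_eq, e, Matrix.mulVec, dotProduct]
  refine (Finset.abs_sum_le_sum_abs _ _).trans (Finset.sum_le_sum fun j _ => ?_)
  have h1 : |coeffProd θ α η m t ω ⟨0, hp⟩ j| ≤ C * ν 1 * exp (-(c * m)) := by
    refine (hentry _ _ _).trans ?_
    rw [mul_assoc]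
    refine mul_le_mul_of_nonneg_left ?_ hC
    exact (algebraNorm_coeffProd_le ν θ α η m t ω).trans
      (mul_le_mul_of_nonneg_left hmω (apply_nonneg ν _))
  rw [abs_mul, Phi, show t - (m : ℤ) - (j : ℤ) = t - j - m by ring, ← mul_assoc]
  exact mul_le_mul_of_nonneg_right h1 (abs_nonneg _)

/-- A square-integrable stationary solution is causal: it is a shift-equivariant function of
the past of the noise. -/
theorem IsRCAR.exists_causal (hp : 1 ≤ p) (h : IsRCAR P θ α ε η X)
    (hm : FiniteSecondMoments P η X) :
    ∃ G : (ℤ → ℝ × (Fin p → ℝ)) → ℝ, Measurable[coordSigma _ (Set.Iic 0)] G ∧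
      ∀ t : ℤ, X t =ᵐ[P] fun ω => G (shift t (noisePath ε η ω)) := by
  -- The limit is taken on the canonical space at time `0`, where every iterate depends on
  -- coordinates in `Iic 0`. The default value of `limUnder` where the iterates diverge is harmless:
  -- it keeps measurability, and equality with `X_t` is needed almost surely only.
  refine ⟨fun z => limUnder atTop fun m => vecIter θ α coordEps coordEta m 0 z ⟨0, hp⟩, ?_, ?_⟩
  · exact (@StronglyMeasurable.limUnder _ _ _ (coordSigma _ (Set.Iic 0)) _ _ _ _ _ _ _ fun m =>
      (measurable_vecIter θ α m le_rfl ⟨0, hp⟩).stronglyMeasurable).measurable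
  · intro t
    filter_upwards [h.ae_tendsto_vecIter hp hm t] with ω hω
    simp only [vecIter_shift, zero_add, vecIter_noisePath]
    exact hω.limUnder_eq.symm

theorem IsRCAR.pastMeasurable (hp : 1 ≤ p) (h : IsRCAR P θ α ε η X)
    (hm : FiniteSecondMoments P η X) {s t : ℤ} (hst : s ≤ t) : PastMeasurable P ε η t (X s) := by
  obtain ⟨G, hG, hX⟩ := h.exists_causal hp hm
  refine ⟨fun z => G (shift s z), hG.comp (measurable_shift_coordSigma fun i hi => ?_), hX s⟩
  rw [Set.mem_Iic] at hi ⊢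
  omega

/-- The past of the noise is independent of the next noise vector. -/
theorem PastMeasurable.indepFun (h : IsNoise P ε η) {s t : ℤ} (hst : s < t) {W : Ω → ℝ}
    (hW : PastMeasurable P ε η s W) {φ : ℝ × (Fin p → ℝ) → ℝ} (hφ : Measurable φ) :
    IndepFun W (fun ω => φ (ε t ω, fun k => η k t ω)) P := by
  obtain ⟨w, hw, hWw⟩ := hW
  have := h.isProbabilityMeasure_noiseLaw
  have hmp := h.measurePreserving_noisePath
  refine IndepFun.congr (f := fun ω => w (noisePath ε η ω)) ?_ hWw.symm EventuallyEq.rfl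
  have hφt : Measurable[coordSigma (ℝ × (Fin p → ℝ)) {t}] fun z => φ (z t) :=
    hφ.comp (measurable_coord rfl)
  have hind := indep_coordSigma (noiseLaw P ε η) (I := Set.Iic s) (J := {t})
    (by rw [Set.disjoint_singleton_right, Set.mem_Iic]; omega)
  rw [indepFun_iff_measure_inter_preimage_eq_mul]
  intro A B hA hB
  have key := (Indep_iff _ _ _).1 hind _ _ (hw hA) (hφt hB)
  have m1 := coordSigma_le _ _ (hw hA)
  have m2 := coordSigma_le _ _ (hφt hB)
  rw [← hmp.measure_preimage m1.nullMeasurableSet, ← hmp.measure_preimage m2.nullMeasurableSet,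
    ← hmp.measure_preimage (m1.inter m2).nullMeasurableSet] at key
  exact key

theorem PastMeasurable.integral_mul (h : IsNoise P ε η) {s t : ℤ} (hst : s < t) {W : Ω → ℝ}
    (hW : PastMeasurable P ε η s W) (hWm : Measurable W) {φ : ℝ × (Fin p → ℝ) → ℝ}
    (hφ : Measurable φ) :
    ∫ ω, W ω * φ (ε t ω, fun k => η k t ω) ∂P
      = (∫ ω, W ω ∂P) * ∫ ω, φ (ε 0 ω, fun k => η k 0 ω) ∂P := by
  have e : ∫ ω, φ (ε t ω, fun k => η k t ω) ∂P = ∫ ω, φ (ε 0 ω, fun k => η k 0 ω) ∂P :=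
    ((h.identDistrib t).comp hφ).integral_eq
  rw [← e]
  exact (hW.indepFun h hst hφ).integral_fun_mul_eq_mul_integral hWm.aestronglyMeasurable
    (hφ.comp (h.measurable_vec t)).aestronglyMeasurable

theorem PastMeasurable.integrable_mul (h : IsNoise P ε η) {s t : ℤ} (hst : s < t) {W : Ω → ℝ}
    (hW : PastMeasurable P ε η s W) (hWi : Integrable W P) {φ : ℝ × (Fin p → ℝ) → ℝ}
    (hφ : Measurable φ) (hφi : Integrable (fun ω => φ (ε 0 ω, fun k => η k 0 ω)) P) :
    Integrable (fun ω => W ω * φ (ε t ω, fun k => η k t ω)) P :=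
  (hW.indepFun h hst hφ).integrable_mul hWi (((h.identDistrib t).comp hφ).integrable_iff.2 hφi)

end Causality

end RCAR

/-! ### The Yule–Walker equations and the bias -/

namespace RCAR

section YuleWalker

variable {Ω : Type*} [MeasurableSpace Ω] {P : Measure Ω} {p : ℕ}
  {θ α : Fin p → ℝ} {ε : ℤ → Ω → ℝ} {η : Fin p → ℤ → Ω → ℝ} {X : ℤ → Ω → ℝ}

theorem IsRCAR.integral_mul_eq_autocov (h : IsRCAR P θ α ε η X) (s t : ℤ) :
    ∫ ω, X s ω * X t ω ∂P = autocov P X (s - t).natAbs := by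
  have aux : ∀ (s t : ℤ), t ≤ s → ∫ ω, X s ω * X t ω ∂P = autocov P X (s - t).natAbs := by
    intro s t hst
    have := (h.identDistrib_mul (s - t) 0 t).integral_eq
    rw [sub_add_cancel, zero_add] at this
    rw [this, autocov, Int.natAbs_of_nonneg (by omega)]
  rcases le_total t s with hst | hst
  · exact aux s t hst
  · rw [← Int.natAbs_neg, neg_sub, ← aux t s hst]
    exact integral_congr_ae (Eventually.of_forall fun ω => mul_comm _ _)

variable [IsProbabilityMeasure P]

theorem IsNoise.integrable_eta (h : IsNoise P ε η) (k : Fin p) : Integrable (η k 0) P :=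
  (h.memLp_eta k).integrable one_le_two

theorem IsNoise.integrable_eps (h : IsNoise P ε η) : Integrable (ε 0) P :=
  h.memLp_eps.integrable one_le_two

theorem IsNoise.integral_eta (h : IsNoise P ε η) (k : Fin p) : ∫ ω, η k 0 ω ∂P = 0 := by
  simpa using h.odd_eta k 1 odd_one (by simpa using h.integrable_eta k)

theorem IsNoise.integral_eps (h : IsNoise P ε η) : ∫ ω, ε 0 ω ∂P = 0 := by
  simpa using h.odd_eps 1 odd_one (by simpa using h.integrable_eps)

theorem measurable_vec_eta (k : Fin p) : Measurable fun e : ℝ × (Fin p → ℝ) => e.2 k :=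
  (measurable_pi_apply k).comp measurable_snd

/-- The products entering the bias vector are integrable. -/
theorem IsRCAR.integrable_mul_mul_eta (hp : 1 ≤ p) (h : IsRCAR P θ α ε η X)
    (hm : FiniteSecondMoments P η X) (i k : Fin p) :
    Integrable (fun ω => X (-(i : ℤ)) ω * X (-(k : ℤ)) ω * η k 0 ω) P := by
  have hL : MemLp (fun ω => η k 0 ω * X 0 ω) 2 P := by
    have hmeas : Measurable fun ω => η k 0 ω * X 0 ω :=
      (h.noise.measurable_eta k 0).mul (h.measurable 0)
    rw [memLp_two_iff_integrable_sq hmeas.aestronglyMeasurable]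
    simpa only [mul_pow] using hm 2 le_rfl k 0
  -- If one index is zero, `X_0` and `η_{k,0}` are dependent, and the moment condition with exponent
  -- `2` puts `η_{k,0} X_0` in `L²`, to be paired with the other factor. If neither is zero, both
  -- factors precede time `0` and independence applies.
  by_cases hi : (i : ℕ) = 0
  · have := hL.integrable_mul (h.memLp hp hm (-(k : ℤ)))
    refine this.congr (Eventually.of_forall fun ω => ?_)
    simp only [Pi.mul_apply, hi, Nat.cast_zero, neg_zero]
    ring
  by_cases hk : (k : ℕ) = 0
  · have := hL.integrable_mul (h.memLp hp hm (-(i : ℤ)))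
    refine this.congr (Eventually.of_forall fun ω => ?_)
    simp only [Pi.mul_apply, hk, Nat.cast_zero, neg_zero]
    ring
  · have hW : PastMeasurable P ε η (-1) fun ω => X (-(i : ℤ)) ω * X (-(k : ℤ)) ω :=
      (h.pastMeasurable hp hm (by omega)).mul (h.pastMeasurable hp hm (by omega))
    exact hW.integrable_mul h.noise (by norm_num : (-1 : ℤ) < 0) (h.integrable_mul hp hm _ _)
      (measurable_vec_eta k) (h.noise.integrable_eta k)

/-- The Yule–Walker equations, with the bias caused by the correlation of the coefficients. -/
theorem IsRCAR.L1_eq (hp : 1 ≤ p) (h : IsRCAR P θ α ε η X) (hm : FiniteSecondMoments P η X) :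
    L1 P p X = Lambda0 P p X *ᵥ θ + biasVec P α η X := by
  funext i
  have hpast : ∀ k : Fin p, PastMeasurable P ε η 0 fun ω => X (-(k : ℤ)) ω * X (-(i : ℤ)) ω :=
    fun k => (h.pastMeasurable hp hm (by omega)).mul (h.pastMeasurable hp hm (by omega))
  have e0 : L1 P p X i = ∫ ω, X 1 ω * X (-(i : ℤ)) ω ∂P := by
    rw [h.integral_mul_eq_autocov, L1]
    congr 1
    omega
  -- Pairing with `X_{-i}`, `i ≥ 0`, makes everything except `η_{k,1}` and `ε_1` a function of the
  -- noise up to time `0`; these two have mean zero as odd first moments, and only the `η_{k,0}`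
  -- terms remain as bias.
  have e1 : (fun ω => X 1 ω * X (-(i : ℤ)) ω) =ᵐ[P] fun ω =>
      ∑ k : Fin p, (θ k * (X (-(k : ℤ)) ω * X (-(i : ℤ)) ω)
        + α k * (X (-(i : ℤ)) ω * X (-(k : ℤ)) ω * η k 0 ω)
        + X (-(k : ℤ)) ω * X (-(i : ℤ)) ω * η k 1 ω) + X (-(i : ℤ)) ω * ε 1 ω := by
    filter_upwards [h.recursion 1] with ω hω
    rw [hω, add_mul, Finset.sum_mul, mul_comm (ε 1 ω)]
    congr 1
    refine Finset.sum_congr rfl fun k _ => ?_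
    rw [show (1 : ℤ) - ((k : ℤ) + 1) = -k by ring, sub_self]
    ring
  have i1 : ∀ k : Fin p, Integrable (fun ω => θ k * (X (-(k : ℤ)) ω * X (-(i : ℤ)) ω)) P :=
    fun k => (h.integrable_mul hp hm _ _).const_mul _
  have i2 : ∀ k : Fin p,
      Integrable (fun ω => α k * (X (-(i : ℤ)) ω * X (-(k : ℤ)) ω * η k 0 ω)) P :=
    fun k => (h.integrable_mul_mul_eta hp hm i k).const_mul _
  have i3 : ∀ k : Fin p, Integrable (fun ω => X (-(k : ℤ)) ω * X (-(i : ℤ)) ω * η k 1 ω) P :=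
    fun k => (hpast k).integrable_mul h.noise (by norm_num) (h.integrable_mul hp hm _ _)
      (measurable_vec_eta k) (h.noise.integrable_eta k)
  have hXi : PastMeasurable P ε η 0 (X (-(i : ℤ))) := h.pastMeasurable hp hm (by omega)
  have i4 : Integrable (fun ω => X (-(i : ℤ)) ω * ε 1 ω) P :=
    hXi.integrable_mul h.noise (by norm_num)
      ((h.memLp hp hm _).integrable one_le_two) measurable_fst h.noise.integrable_eps
  have z3 : ∀ k : Fin p, ∫ ω, X (-(k : ℤ)) ω * X (-(i : ℤ)) ω * η k 1 ω ∂P = 0 := by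
    intro k
    have := (hpast k).integral_mul h.noise (by norm_num : (0 : ℤ) < 1)
      ((h.measurable _).mul (h.measurable _)) (measurable_vec_eta k)
    rw [h.noise.integral_eta k, mul_zero] at this
    exact this
  have z4 : ∫ ω, X (-(i : ℤ)) ω * ε 1 ω ∂P = 0 := by
    have := hXi.integral_mul h.noise (by norm_num : (0 : ℤ) < 1)
      (h.measurable _) (φ := fun e => e.1) measurable_fst
    rw [h.noise.integral_eps, mul_zero] at this
    exact this
  have h12 : ∀ k : Fin p, Integrable (fun ω => θ k * (X (-(k : ℤ)) ω * X (-(i : ℤ)) ω)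
      + α k * (X (-(i : ℤ)) ω * X (-(k : ℤ)) ω * η k 0 ω)) P := fun k => (i1 k).add (i2 k)
  have h123 : ∀ k : Fin p, Integrable (fun ω => θ k * (X (-(k : ℤ)) ω * X (-(i : ℤ)) ω)
      + α k * (X (-(i : ℤ)) ω * X (-(k : ℤ)) ω * η k 0 ω)
      + X (-(k : ℤ)) ω * X (-(i : ℤ)) ω * η k 1 ω) P := fun k => (h12 k).add (i3 k)
  rw [e0, integral_congr_ae e1, integral_add (integrable_finsetSum _ fun k _ => h123 k) i4, z4,
    add_zero, integral_finsetSum _ fun k _ => h123 k]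
  rw [Pi.add_apply, biasVec, Matrix.mulVec, dotProduct, ← Finset.sum_add_distrib]
  refine Finset.sum_congr rfl fun k _ => ?_
  rw [integral_add (h12 k) (i3 k), z3, add_zero, integral_add (i1 k) (i2 k), integral_const_mul,
    integral_const_mul, h.integral_mul_eq_autocov, Lambda0, Matrix.of_apply, mul_comm (θ k)]
  congr 3
  omega

theorem IsRCAR.thetaStar_eq (hp : 1 ≤ p) (h : IsRCAR P θ α ε η X)
    (hm : FiniteSecondMoments P η X) (hdet : IsUnit (Lambda0 P p X).det) :
    thetaStar P p X = θ + (Lambda0 P p X)⁻¹ *ᵥ biasVec P α η X := by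
  rw [thetaStar, h.L1_eq hp hm, Matrix.mulVec_add, Matrix.mulVec_mulVec,
    Matrix.nonsing_inv_mul _ hdet, Matrix.one_mulVec]

end YuleWalker

/-! ### Convergence of the least squares estimator -/

section Consistency

variable {Ω : Type*} [MeasurableSpace Ω] {P : Measure Ω} [IsProbabilityMeasure P] {p : ℕ}
  {θ α : Fin p → ℝ} {ε : ℤ → Ω → ℝ} {η : Fin p → ℤ → Ω → ℝ} {X : ℤ → Ω → ℝ}

/-- The empirical autocovariances converge almost surely. -/
theorem IsRCAR.ae_tendsto_average_mul (hp : 1 ≤ p) (h : IsRCAR P θ α ε η X)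
    (hm : FiniteSecondMoments P η X) (s t : ℤ) :
    ∀ᵐ ω ∂P, Tendsto (fun n : ℕ =>
      (∑ k ∈ Finset.range n, X (s + k) ω * X (t + k) ω) / n) atTop
      (𝓝 (∫ ω, X s ω * X t ω ∂P)) := by
  obtain ⟨G, hG, hX⟩ := h.exists_causal hp hm
  have hGm : Measurable G := hG.mono (coordSigma_le _) le_rfl
  have hf : Measurable fun z => G (shift s z) * G (shift t z) :=
    (hGm.comp (measurable_shift s)).mul (hGm.comp (measurable_shift t))
  have hst : (fun ω => X s ω * X t ω) =ᵐ[P] fun ω =>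
      G (shift s (noisePath ε η ω)) * G (shift t (noisePath ε η ω)) := (hX s).mul (hX t)
  have := h.noise.ae_tendsto_average one_ne_zero hf ((h.integrable_mul hp hm s t).congr hst)
  filter_upwards [this, ae_all_iff.2 hX] with ω hω hXω
  rw [integral_congr_ae hst]
  refine hω.congr fun n => ?_
  congr 1
  refine Finset.sum_congr rfl fun k _ => ?_
  rw [shift_shift, shift_shift, hXω, hXω, mul_one]

theorem IsRCAR.ae_tendsto_gram (hp : 1 ≤ p) (h : IsRCAR P θ α ε η X)
    (hm : FiniteSecondMoments P η X) :
    ∀ᵐ ω ∂P, Tendsto (fun n : ℕ => (n : ℝ)⁻¹ • gram p X n ω) atTop (𝓝 (Lambda0 P p X)) := by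
  have := ae_all_iff.2 fun i : Fin p => ae_all_iff.2 fun j : Fin p =>
    h.ae_tendsto_average_mul hp hm (-(i : ℤ)) (-(j : ℤ))
  filter_upwards [this] with ω hω
  refine tendsto_pi_nhds.2 fun i => tendsto_pi_nhds.2 fun j => ?_
  have e : Lambda0 P p X i j = ∫ ω, X (-(i : ℤ)) ω * X (-(j : ℤ)) ω ∂P := by
    rw [h.integral_mul_eq_autocov, Lambda0, Matrix.of_apply]
    congr 1
    omega
  rw [e]
  refine (hω i j).congr fun n => ?_
  rw [Matrix.smul_apply, gram, Matrix.sum_apply, smul_eq_mul, div_eq_inv_mul]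
  congr 1
  refine Finset.sum_congr rfl fun k _ => ?_
  rw [Matrix.vecMulVec_apply, Phi, Phi, neg_add_eq_sub, neg_add_eq_sub]

theorem IsRCAR.ae_tendsto_cross (hp : 1 ≤ p) (h : IsRCAR P θ α ε η X)
    (hm : FiniteSecondMoments P η X) :
    ∀ᵐ ω ∂P, Tendsto (fun n : ℕ =>
      (n : ℝ)⁻¹ • ∑ t ∈ Finset.Icc 1 n, X (t : ℤ) ω • Phi p X ((t : ℤ) - 1) ω) atTop
      (𝓝 (L1 P p X)) := by
  have := ae_all_iff.2 fun i : Fin p => h.ae_tendsto_average_mul hp hm 1 (-(i : ℤ))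
  filter_upwards [this] with ω hω
  refine tendsto_pi_nhds.2 fun i => ?_
  have e : L1 P p X i = ∫ ω, X 1 ω * X (-(i : ℤ)) ω ∂P := by
    rw [h.integral_mul_eq_autocov, L1]
    congr 1
    omega
  rw [e]
  refine (hω i).congr fun n => ?_
  rw [Pi.smul_apply, Finset.sum_apply, smul_eq_mul, div_eq_inv_mul,
    ← Finset.Ico_add_one_right_eq_Icc, Finset.sum_Ico_eq_sum_range, Nat.add_sub_cancel]
  congr 1
  refine Finset.sum_congr rfl fun k _ => ?_
  rw [Pi.smul_apply, smul_eq_mul, Phi]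
  push_cast
  rw [show (1 : ℤ) + k - 1 - i = -(i : ℤ) + k by ring]

/-- By Cramer's rule the inverse is `det⁻¹` times the adjugate, continuous at `B` because `det B ≠
0`; the `A n` themselves need not all be invertible. -/
theorem tendsto_inv_mulVec {A : ℕ → Matrix (Fin p) (Fin p) ℝ} {B : Matrix (Fin p) (Fin p) ℝ}
    {v : ℕ → Fin p → ℝ} {w : Fin p → ℝ} (hB : IsUnit B.det) (hA : Tendsto A atTop (𝓝 B))
    (hv : Tendsto v atTop (𝓝 w)) :
    Tendsto (fun n => (A n)⁻¹ *ᵥ v n) atTop (𝓝 (B⁻¹ *ᵥ w)) := by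
  have cdet : Continuous fun M : Matrix (Fin p) (Fin p) ℝ => M.det :=
    continuous_id.matrix_det
  have cadj : Continuous fun M : Matrix (Fin p) (Fin p) ℝ => M.adjugate :=
    continuous_id.matrix_adjugate
  have hdet : Tendsto (fun n => (A n).det) atTop (𝓝 B.det) :=
    (cdet.tendsto B).comp hA
  have hadj : Tendsto (fun n => (A n).adjugate) atTop (𝓝 B.adjugate) :=
    (cadj.tendsto B).comp hA
  have hinv : Tendsto (fun n => (A n)⁻¹) atTop (𝓝 B⁻¹) := by
    simp only [Matrix.inv_def, Ring.inverse_eq_inv']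
    exact (hdet.inv₀ hB.ne_zero).smul hadj
  refine tendsto_pi_nhds.2 fun i => ?_
  simp only [Matrix.mulVec, dotProduct]
  exact tendsto_finsetSum _ fun j _ =>
    (tendsto_pi_nhds.1 (tendsto_pi_nhds.1 hinv i) j).mul (tendsto_pi_nhds.1 hv j)

/-- Almost sure convergence of the least squares estimator. -/
theorem IsRCAR.ae_tendsto_ols (hp : 1 ≤ p) (h : IsRCAR P θ α ε η X)
    (hm : FiniteSecondMoments P η X) (hdet : IsUnit (Lambda0 P p X).det) :
    ∀ᵐ ω ∂P, (∀ᶠ n : ℕ in atTop, IsUnit (gram p X n ω).det) ∧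
      Tendsto (fun n : ℕ => ols p X n ω) atTop (𝓝 (thetaStar P p X)) := by
  filter_upwards [h.ae_tendsto_gram hp hm, h.ae_tendsto_cross hp hm] with ω hG hC
  have hdetlim : Tendsto (fun n : ℕ => ((n : ℝ)⁻¹ • gram p X n ω).det) atTop
      (𝓝 (Lambda0 P p X).det) := ((Continuous.matrix_det continuous_id).tendsto (Lambda0 P p X)).comp hG
  have hunit : ∀ᶠ n : ℕ in atTop, IsUnit (gram p X n ω).det := by
    filter_upwards [hdetlim.eventually_ne hdet.ne_zero] with n hn
    rw [Matrix.det_smul] at hn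
    exact (right_ne_zero_of_mul hn).isUnit
  refine ⟨hunit, ?_⟩
  have hmv := tendsto_inv_mulVec hdet hG hC
  -- The factors `n⁻¹` in the Gram matrix and in the cross sum cancel for `n > 0`.
  refine hmv.congr' ?_
  filter_upwards [hunit, eventually_gt_atTop 0] with n hn hn0
  have hn0' : (n : ℝ)⁻¹ ≠ 0 := inv_ne_zero (by exact_mod_cast hn0.ne')
  have e : ((n : ℝ)⁻¹ • gram p X n ω)⁻¹ = (n : ℝ) • (gram p X n ω)⁻¹ := by
    refine Matrix.inv_eq_right_inv ?_
    rw [Matrix.smul_mul, Matrix.mul_smul, smul_smul, Matrix.mul_nonsing_inv _ hn,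
      inv_mul_cancel₀ (by exact_mod_cast hn0.ne'), one_smul]
  rw [e, Matrix.smul_mulVec, Matrix.mulVec_smul, smul_smul,
    mul_inv_cancel₀ (by exact_mod_cast hn0.ne'), one_smul, ols]

/-- The estimator does not converge in probability to a point other than its limit. -/
theorem IsRCAR.not_tendstoInMeasure_ols (hp : 1 ≤ p) (h : IsRCAR P θ α ε η X)
    (hm : FiniteSecondMoments P η X) (hdet : IsUnit (Lambda0 P p X).det)
    (hne : thetaStar P p X ≠ θ) :
    ¬ TendstoInMeasure P (fun (n : ℕ) (ω : Ω) => ols p X n ω) atTop fun _ => θ := by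
  intro hlim
  -- Convergence in probability gives almost sure convergence along a subsequence, contradicting
  -- uniqueness of the almost sure limit.
  obtain ⟨ns, hns, hae⟩ := hlim.exists_seq_tendsto_ae
  obtain ⟨ω, hω, hω'⟩ := (hae.and (h.ae_tendsto_ols hp hm hdet)).exists
  exact hne (tendsto_nhds_unique (hω'.2.comp hns.tendsto_atTop) hω)

end Consistency

end RCAR

/-! ### A weighted row-sum norm for checking stability -/

section WeightedNorm

/-- The row-sum norm on matrices, conjugated by a diagonal matrix of positive weights. -/
noncomputable def weightedNorm {p : ℕ} (w : Fin p → ℝ) (hw : ∀ i, 0 < w i) :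
    AlgebraNorm ℝ (Matrix (Fin p) (Fin p) ℝ) :=
  letI : NormedRing (Matrix (Fin p) (Fin p) ℝ) := Matrix.linftyOpNormedRing
  letI : NormedAlgebra ℝ (Matrix (Fin p) (Fin p) ℝ) := Matrix.linftyOpNormedAlgebra
  have hinv : Matrix.diagonal w⁻¹ * Matrix.diagonal w = 1 := by
    rw [Matrix.diagonal_mul_diagonal, ← Matrix.diagonal_one]
    congr 1
    funext i
    exact inv_mul_cancel₀ (hw i).ne'
  { toFun M := ‖Matrix.diagonal w * M * Matrix.diagonal w⁻¹‖
    map_zero' := by simp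
    add_le' M N := by
      rw [Matrix.mul_add, Matrix.add_mul]
      exact norm_add_le _ _
    neg' M := by simp
    mul_le' M N := by
      refine le_of_eq_of_le (congrArg norm ?_) (norm_mul_le _ _)
      calc Matrix.diagonal w * (M * N) * Matrix.diagonal w⁻¹
          = Matrix.diagonal w * M * 1 * N * Matrix.diagonal w⁻¹ := by
            simp only [Matrix.mul_one, Matrix.mul_assoc]
        _ = _ := by rw [← hinv]; simp only [Matrix.mul_assoc]
    eq_zero_of_map_eq_zero' M hM := by
      have h0 : Matrix.diagonal w * M * Matrix.diagonal w⁻¹ = 0 := norm_eq_zero.1 hM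
      ext i j
      have := congrFun (congrFun h0 i) j
      rw [Matrix.mul_diagonal, Matrix.diagonal_mul] at this
      simpa [(hw i).ne', (hw j).ne'] using this
    smul' a M := by
      rw [Matrix.mul_smul, Matrix.smul_mul]
      exact norm_smul _ _ }

theorem weightedNorm_le {p : ℕ} {w : Fin p → ℝ} (hw : ∀ i, 0 < w i)
    {M : Matrix (Fin p) (Fin p) ℝ} {r : ℝ} (hr : 0 ≤ r)
    (h : ∀ i, ∑ j, |w i * M i j * (w j)⁻¹| ≤ r) : weightedNorm w hw M ≤ r := by
  let : NormedRing (Matrix (Fin p) (Fin p) ℝ) := Matrix.linftyOpNormedRing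
  change ‖Matrix.diagonal w * M * Matrix.diagonal w⁻¹‖ ≤ r
  rw [Matrix.linfty_opNorm_def]
  lift r to NNReal using hr
  rw [NNReal.coe_le_coe]
  refine Finset.sup_le fun i _ => ?_
  rw [← NNReal.coe_le_coe]
  refine le_of_eq_of_le ?_ (h i)
  push_cast
  refine Finset.sum_congr rfl fun j _ => ?_
  rw [Matrix.mul_diagonal, Matrix.diagonal_mul, Real.norm_eq_abs, Pi.inv_apply]

theorem expLogNeg_of_le {Ω : Type*} [MeasurableSpace Ω] {P : Measure Ω} [IsProbabilityMeasure P]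
    {Y : Ω → ℝ} {r : ℝ} (hr : 0 < r) (hr1 : r < 1) (hY : ∀ ω, Y ω ≤ r) :
    RCAR.ExpLogNeg P Y := by
  have hle : ∀ ω, ENNReal.log (ENNReal.ofReal (Y ω)) ≤ (log r : EReal) := fun ω => by
    rw [← ENNReal.log_ofReal_of_pos hr]
    exact ENNReal.log_monotone (ENNReal.ofReal_le_ofReal (hY ω))
  have hneg : log r < 0 := log_neg hr hr1
  have h1 : ∫⁻ ω, (ENNReal.log (ENNReal.ofReal (Y ω))).toENNReal ∂P = 0 := by
    have : ∀ ω, (ENNReal.log (ENNReal.ofReal (Y ω))).toENNReal = 0 := fun ω =>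
      EReal.toENNReal_of_nonpos ((hle ω).trans (by exact_mod_cast hneg.le))
    simp only [this, lintegral_zero]
  have h2 : ENNReal.ofReal (-log r)
      ≤ ∫⁻ ω, (-ENNReal.log (ENNReal.ofReal (Y ω))).toENNReal ∂P := by
    calc ENNReal.ofReal (-log r) = ∫⁻ _, ENNReal.ofReal (-log r) ∂P := by simp
      _ ≤ _ := lintegral_mono fun ω => by
        rw [← EReal.real_coe_toENNReal, EReal.coe_neg]
        exact EReal.toENNReal_le_toENNReal (EReal.neg_le_neg_iff.2 (hle ω))
  rw [RCAR.ExpLogNeg, h1]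
  exact lt_of_lt_of_le (ENNReal.ofReal_pos.2 (by linarith)) h2

end WeightedNorm

/-! ### Bounded solutions by Picard iteration -/

namespace RCAR

section Contraction

variable {Ω : Type*} {p : ℕ} {θ α : Fin p → ℝ} {ε : ℤ → Ω → ℝ} {η : Fin p → ℤ → Ω → ℝ}

/-- The random coefficient of lag `k + 1` at time `t`. -/
def lagCoeff (θ α : Fin p → ℝ) (η : Fin p → ℤ → Ω → ℝ) (k : Fin p) (t : ℤ) (ω : Ω) : ℝ :=
  θ k + α k * η k (t - 1) ω + η k t ω

/-- The Picard iterates of the scalar recursion. -/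
def scalarIter (θ α : Fin p → ℝ) (ε : ℤ → Ω → ℝ) (η : Fin p → ℤ → Ω → ℝ) :
    ℕ → ℤ → Ω → ℝ
  | 0, _, _ => 0
  | m + 1, t, ω => ∑ k : Fin p, lagCoeff θ α η k t ω
      * scalarIter θ α ε η m (t - ((k : ℤ) + 1)) ω + ε t ω

/-- The limit of the Picard iterates of the scalar recursion. -/
noncomputable def picardLimit (θ α : Fin p → ℝ) (ε : ℤ → Ω → ℝ) (η : Fin p → ℤ → Ω → ℝ)
    (t : ℤ) (ω : Ω) : ℝ :=
  limUnder atTop fun m => scalarIter θ α ε η m t ω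

theorem abs_sum_lagCoeff_mul_le {ω : Ω} (hη : ∀ t, ∑ k, |lagCoeff θ α η k t ω| ≤ 1 / 2) (t : ℤ)
    {x : Fin p → ℝ} {B : ℝ} (hB : 0 ≤ B) (hx : ∀ k, |x k| ≤ B) :
    |∑ k, lagCoeff θ α η k t ω * x k| ≤ B / 2 := by
  calc |∑ k, lagCoeff θ α η k t ω * x k| ≤ ∑ k, |lagCoeff θ α η k t ω| * B := by
        refine (Finset.abs_sum_le_sum_abs _ _).trans (Finset.sum_le_sum fun k _ => ?_)
        rw [abs_mul]
        exact mul_le_mul_of_nonneg_left (hx k) (abs_nonneg _)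
    _ = (∑ k, |lagCoeff θ α η k t ω|) * B := (Finset.sum_mul _ _ _).symm
    _ ≤ 1 / 2 * B := mul_le_mul_of_nonneg_right (hη t) hB
    _ = B / 2 := by ring

/-- The bound `2` is the fixed point of `B ↦ B / 2 + 1`. -/
theorem abs_scalarIter_le {ω : Ω} (hη : ∀ t, ∑ k, |lagCoeff θ α η k t ω| ≤ 1 / 2)
    (hε : ∀ t, |ε t ω| ≤ 1) (m : ℕ) (t : ℤ) : |scalarIter θ α ε η m t ω| ≤ 2 := by
  induction m generalizing t with
  | zero => simp [scalarIter]
  | succ m ih =>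
    rw [scalarIter]
    have := abs_sum_lagCoeff_mul_le hη t zero_le_two fun k => ih (t - ((k : ℤ) + 1))
    exact (abs_add_le _ _).trans (by linarith [hε t])

theorem abs_scalarIter_succ_sub_le {ω : Ω} (hη : ∀ t, ∑ k, |lagCoeff θ α η k t ω| ≤ 1 / 2)
    (hε : ∀ t, |ε t ω| ≤ 1) (m : ℕ) (t : ℤ) :
    |scalarIter θ α ε η (m + 1) t ω - scalarIter θ α ε η m t ω| ≤ (1 / 2) ^ m := by
  induction m generalizing t with
  | zero => simpa [scalarIter] using hε t
  | succ m ih =>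
    have e : scalarIter θ α ε η (m + 1 + 1) t ω - scalarIter θ α ε η (m + 1) t ω
        = ∑ k : Fin p, lagCoeff θ α η k t ω * (scalarIter θ α ε η (m + 1) (t - ((k : ℤ) + 1)) ω
          - scalarIter θ α ε η m (t - ((k : ℤ) + 1)) ω) := by
      rw [scalarIter]
      conv_lhs => arg 2; rw [scalarIter]
      rw [add_sub_add_right_eq_sub, ← Finset.sum_sub_distrib]
      exact Finset.sum_congr rfl fun k _ => (mul_sub _ _ _).symm
    rw [e]
    exact (abs_sum_lagCoeff_mul_le hη t (by positivity) fun k => ih _).trans_eq (by ring)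

theorem tendsto_scalarIter {ω : Ω} (hη : ∀ t, ∑ k, |lagCoeff θ α η k t ω| ≤ 1 / 2)
    (hε : ∀ t, |ε t ω| ≤ 1) (t : ℤ) :
    Tendsto (fun m => scalarIter θ α ε η m t ω) atTop (𝓝 (picardLimit θ α ε η t ω)) := by
  refine tendsto_nhds_limUnder (cauchySeq_tendsto_of_complete ?_)
  refine cauchySeq_of_le_geometric (1 / 2) 1 (by norm_num) fun m => ?_
  rw [dist_comm, Real.dist_eq, one_mul]
  exact abs_scalarIter_succ_sub_le hη hε m t

theorem abs_picardLimit_le {ω : Ω} (hη : ∀ t, ∑ k, |lagCoeff θ α η k t ω| ≤ 1 / 2)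
    (hε : ∀ t, |ε t ω| ≤ 1) (t : ℤ) : |picardLimit θ α ε η t ω| ≤ 2 :=
  le_of_tendsto (tendsto_scalarIter hη hε t).abs
    (Eventually.of_forall fun m => abs_scalarIter_le hη hε m t)

theorem picardLimit_eq {ω : Ω} (hη : ∀ t, ∑ k, |lagCoeff θ α η k t ω| ≤ 1 / 2)
    (hε : ∀ t, |ε t ω| ≤ 1) (t : ℤ) :
    picardLimit θ α ε η t ω = ∑ k : Fin p, (θ k + α k * η k (t - 1) ω + η k t ω)
      * picardLimit θ α ε η (t - ((k : ℤ) + 1)) ω + ε t ω := by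
  refine tendsto_nhds_unique ((tendsto_scalarIter hη hε t).comp (tendsto_add_atTop_nat 1)) ?_
  have : Tendsto (fun m => ∑ k : Fin p, lagCoeff θ α η k t ω
      * scalarIter θ α ε η m (t - ((k : ℤ) + 1)) ω + ε t ω) atTop (𝓝 (∑ k : Fin p,
        lagCoeff θ α η k t ω * picardLimit θ α ε η (t - ((k : ℤ) + 1)) ω + ε t ω)) :=
    (tendsto_finsetSum _ fun k _ => (tendsto_scalarIter hη hε _).const_mul _).add_const _
  exact this

theorem measurable_picardLimit [MeasurableSpace Ω] (hεm : ∀ t, Measurable (ε t))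
    (hηm : ∀ k t, Measurable (η k t)) (t : ℤ) : Measurable (picardLimit θ α ε η t) := by
  have h : ∀ m t, Measurable (scalarIter θ α ε η m t) := by
    intro m
    induction m with
    | zero => exact fun t => measurable_const
    | succ m ih =>
      intro t
      refine Measurable.add (Finset.measurable_fun_sum _ fun k _ => ?_) (hεm t)
      exact ((measurable_const.add ((hηm k (t - 1)).const_mul _)).add (hηm k t)).mul (ih _)
  exact (StronglyMeasurable.limUnder fun m => (h m t).stronglyMeasurable).measurable

/-- Shifting time amounts to shifting the driving sequence, so strict stationarity follows from
invariance of the product measure. -/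
theorem picardLimit_shift {E : Type*} (e : E → ℝ) (n : Fin p → E → ℝ) (t s : ℤ) (ω : ℤ → E) :
    picardLimit θ α (fun t ω => e (ω t)) (fun k t ω => n k (ω t)) (t + s) ω
      = picardLimit θ α (fun t ω => e (ω t)) (fun k t ω => n k (ω t)) t (shift s ω) := by
  have h : ∀ m t, scalarIter θ α (fun t (ω : ℤ → E) => e (ω t)) (fun k t ω => n k (ω t)) m (t + s) ω
      = scalarIter θ α (fun t ω => e (ω t)) (fun k t ω => n k (ω t)) m t (shift s ω) := by
    intro m
    induction m with
    | zero => exact fun t => rfl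
    | succ m ih =>
      intro t
      rw [scalarIter, scalarIter]
      congr 1
      refine Finset.sum_congr rfl fun k _ => ?_
      rw [← ih, show t - ((k : ℤ) + 1) + s = t + s - (k + 1) by ring]
      simp only [lagCoeff, shift]
      rw [show t - 1 + s = t + s - 1 by ring]
  simp only [picardLimit, h]

theorem identDistrib_picardLimit {E : Type*} [MeasurableSpace E] (μ : Measure E)
    [IsProbabilityMeasure μ] {e : E → ℝ} {n : Fin p → E → ℝ} (he : Measurable e)
    (hn : ∀ k, Measurable (n k)) (s : ℤ) :
    IdentDistrib
      (fun ω t => picardLimit θ α (fun t (ω : ℤ → E) => e (ω t)) (fun k t ω => n k (ω t)) (t + s) ω)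
      (fun ω t => picardLimit θ α (fun t (ω : ℤ → E) => e (ω t)) (fun k t ω => n k (ω t)) t ω)
      (Measure.infinitePi fun _ : ℤ => μ) (Measure.infinitePi fun _ : ℤ => μ) := by
  have hm : Measurable fun (ω : ℤ → E) (t : ℤ) =>
      picardLimit θ α (fun t (ω : ℤ → E) => e (ω t)) (fun k t ω => n k (ω t)) t ω :=
    measurable_pi_lambda _ fun t => measurable_picardLimit
      (fun t => he.comp (measurable_pi_apply t)) (fun k t => (hn k).comp (measurable_pi_apply t)) t
  simp only [picardLimit_shift]
  refine ⟨(hm.comp (measurable_shift s)).aemeasurable, hm.aemeasurable, ?_⟩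
  conv_rhs => rw [← (measurePreserving_shift μ s).map_eq]
  exact (Measure.map_map hm (measurable_shift s)).symm

end Contraction

end RCAR

/-! ### Noise concentrated on the coordinate axes -/

namespace RCAR

section AxisNoise

variable {p : ℕ}

/-- The sample space of a noise vector that is concentrated on the coordinate axes: a sign and the
index of an axis. -/
abbrev AxisSite (p : ℕ) : Type := Bool × Fin (p + 1)

/-- The sign of a Boolean. -/
def boolSign (s : Bool) : ℝ := if s then 1 else -1

/-- The component along the first axis. -/
def axisEps (x : AxisSite p) : ℝ := if x.2 = 0 then boolSign x.1 else 0

/-- The component along the axis `k + 1`, of size `b k`. -/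
def axisEta (b : Fin p → ℝ) (k : Fin p) (x : AxisSite p) : ℝ :=
  if x.2 = k.succ then b k * boolSign x.1 else 0

/-- The uniform law on signs and axes. -/
noncomputable def axisLaw (p : ℕ) : Measure (AxisSite p) :=
  (PMF.uniformOfFintype (AxisSite p)).toMeasure

instance : IsProbabilityMeasure (axisLaw p) :=
  inferInstanceAs (IsProbabilityMeasure (PMF.uniformOfFintype (AxisSite p)).toMeasure)

/-- The law of an i.i.d. sequence of signs and axes. -/
noncomputable def axisMeasure (p : ℕ) : Measure (ℤ → AxisSite p) :=
  Measure.infinitePi fun _ : ℤ => axisLaw p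

instance : IsProbabilityMeasure (axisMeasure p) :=
  inferInstanceAs (IsProbabilityMeasure (Measure.infinitePi fun _ : ℤ => axisLaw p))

/-- The noise `ε` built from the axis law. -/
def axisNoiseEps (p : ℕ) (t : ℤ) (ω : ℤ → AxisSite p) : ℝ := axisEps (ω t)

/-- The noises `η` built from the axis law. -/
def axisNoiseEta (b : Fin p → ℝ) (k : Fin p) (t : ℤ) (ω : ℤ → AxisSite p) : ℝ :=
  axisEta b k (ω t)

@[simp] theorem boolSign_not (s : Bool) : boolSign (!s) = -boolSign s := by
  cases s <;> simp [boolSign]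

@[simp] theorem boolSign_mul_self (s : Bool) : boolSign s * boolSign s = 1 := by
  cases s <;> simp [boolSign]

@[simp] theorem abs_boolSign (s : Bool) : |boolSign s| = 1 := by
  cases s <;> simp [boolSign]

theorem axisEps_mul_axisEta (b : Fin p → ℝ) (k : Fin p) (x : AxisSite p) :
    axisEps x * axisEta b k x = 0 := by
  rw [axisEps, axisEta]
  split_ifs with h1 h2 <;> simp
  rw [h1] at h2
  exact absurd h2.symm (Fin.succ_ne_zero k)

theorem axisEta_mul_axisEta (b : Fin p → ℝ) {j k : Fin p} (hjk : j ≠ k) (x : AxisSite p) :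
    axisEta b j x * axisEta b k x = 0 := by
  rw [axisEta, axisEta]
  split_ifs with h1 h2 <;> simp
  rw [h1] at h2
  exact absurd (Fin.succ_injective _ h2) hjk

theorem abs_axisEps_le (x : AxisSite p) : |axisEps x| ≤ 1 := by
  rw [axisEps]
  split_ifs <;> simp

theorem abs_axisEta_le {b : Fin p → ℝ} (hb : ∀ k, 0 < b k) (k : Fin p) (x : AxisSite p) :
    |axisEta b k x| ≤ b k := by
  rw [axisEta]
  split_ifs
  · rw [abs_mul, abs_boolSign, mul_one, abs_of_pos (hb k)]
  · simpa using (hb k).le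

theorem integral_axisLaw (f : AxisSite p → ℝ) :
    ∫ x, f x ∂(axisLaw p)
      = (2 * ((p : ℝ) + 1))⁻¹ * ∑ j : Fin (p + 1), (f (true, j) + f (false, j)) := by
  rw [axisLaw, PMF.integral_eq_sum, Finset.mul_sum, Fintype.sum_prod_type_right]
  refine Finset.sum_congr rfl fun j _ => ?_
  have hcard : (2 * (p : ENNReal) + 2).toReal = 2 * p + 2 := by
    rw [show (2 * (p : ENNReal) + 2) = ((2 * p + 2 : ℕ) : ENNReal) by push_cast; rfl,
      ENNReal.toReal_natCast]
    push_cast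
    rfl
  simp [PMF.uniformOfFintype_apply, mul_add, hcard]

theorem integral_axisLaw_of_odd {f : AxisSite p → ℝ} (hf : ∀ s j, f (!s, j) = -f (s, j)) :
    ∫ x, f x ∂(axisLaw p) = 0 := by
  rw [integral_axisLaw]
  have : ∀ j, f (true, j) + f (false, j) = 0 := fun j => by
    have := hf true j
    simp only [Bool.not_true] at this
    linarith
  simp [this]

theorem integral_axisEps_sq : ∫ x, axisEps x * axisEps x ∂(axisLaw p) = ((p : ℝ) + 1)⁻¹ := by
  rw [integral_axisLaw, Finset.sum_eq_single 0]
  · simp only [axisEps, if_true, boolSign_mul_self]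
    rw [mul_inv]
    ring
  · intro j _ hj
    simp [axisEps, hj]
  · simp

theorem integral_axisEta_sq (b : Fin p → ℝ) (k : Fin p) :
    ∫ x, axisEta b k x * axisEta b k x ∂(axisLaw p) = ((p : ℝ) + 1)⁻¹ * b k ^ 2 := by
  rw [integral_axisLaw, Finset.sum_eq_single k.succ]
  · simp only [axisEta, if_true, mul_mul_mul_comm, boolSign_mul_self]
    rw [mul_inv]
    ring
  · intro j _ hj
    simp [axisEta, hj]
  · simp

theorem axisEps_not (s : Bool) (j : Fin (p + 1)) : axisEps (!s, j) = -axisEps (s, j) := by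
  simp only [axisEps, boolSign_not]
  split_ifs <;> simp

theorem axisEta_not (b : Fin p → ℝ) (k : Fin p) (s : Bool) (j : Fin (p + 1)) :
    axisEta b k (!s, j) = -axisEta b k (s, j) := by
  simp only [axisEta, boolSign_not]
  split_ifs <;> simp

theorem measurePreserving_axisMeasure_coord (t : ℤ) :
    MeasurePreserving (fun ω : ℤ → AxisSite p => ω t) (axisMeasure p) (axisLaw p) :=
  measurePreserving_eval_infinitePi (fun _ : ℤ => axisLaw p) t

theorem integral_axisMeasure_coord (f : AxisSite p → ℝ) (t : ℤ) :
    ∫ ω, f (ω t) ∂(axisMeasure p) = ∫ x, f x ∂(axisLaw p) := by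
  have h := measurePreserving_axisMeasure_coord (p := p) t
  have := integral_map (μ := axisMeasure p) h.measurable.aemeasurable (f := f)
    (Measurable.of_discrete (f := f)).aestronglyMeasurable
  rw [h.map_eq] at this
  exact this.symm

theorem measurable_axisMeasure_coord {F : Type*} [MeasurableSpace F] (f : AxisSite p → F) (t : ℤ) :
    Measurable fun ω : ℤ → AxisSite p => f (ω t) :=
  (Measurable.of_discrete (f := f)).comp (measurable_pi_apply t)

theorem memLp_axisMeasure_coord (f : AxisSite p → ℝ) (t : ℤ) :
    MemLp (fun ω : ℤ → AxisSite p => f (ω t)) 2 (axisMeasure p) :=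
  MemLp.of_bound (measurable_axisMeasure_coord f t).aestronglyMeasurable (∑ x, |f x|)
    (Eventually.of_forall fun ω => by
      rw [Real.norm_eq_abs]
      exact Finset.single_le_sum (f := fun x => |f x|) (fun x _ => abs_nonneg _)
        (Finset.mem_univ (ω t)))

theorem covariance_axisMeasure_eq_zero {f g : AxisSite p → ℝ} (h : ∀ x, f x * g x = 0)
    (hf : ∀ s j, f (!s, j) = -f (s, j)) :
    cov[fun ω => f (ω 0), fun ω => g (ω 0); axisMeasure p] = 0 := by
  rw [covariance_eq_sub (memLp_axisMeasure_coord f 0) (memLp_axisMeasure_coord g 0),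
    integral_axisMeasure_coord f 0, integral_axisLaw_of_odd hf]
  simp [h]

/-- Distinct components are never nonzero together, so their products vanish pointwise; flipping the
sign preserves the law and kills all odd moments. -/
theorem isNoise_axis (b : Fin p → ℝ) :
    IsNoise (axisMeasure p) (axisNoiseEps p) (axisNoiseEta b) where
  measurable_eps t := measurable_axisMeasure_coord axisEps t
  measurable_eta k t := measurable_axisMeasure_coord (axisEta b k) t
  indep := iIndepFun_infinitePi (P := fun _ : ℤ => axisLaw p)
    (X := fun _ x => ((axisEps x, fun k => axisEta b k x) : ℝ × (Fin p → ℝ)))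
    fun _ => Measurable.of_discrete
  identDistrib t := by
    set f : AxisSite p → ℝ × (Fin p → ℝ) := fun x => (axisEps x, fun k => axisEta b k x)
    have hf : Measurable f := Measurable.of_discrete
    have h : ∀ t : ℤ, (axisMeasure p).map (fun ω => f (ω t)) = (axisLaw p).map f := fun t => by
      have := Measure.map_map hf (measurable_pi_apply t) (μ := axisMeasure p)
      rw [(measurePreserving_axisMeasure_coord t).map_eq] at this
      exact this.symm
    exact ⟨(measurable_axisMeasure_coord f t).aemeasurable,
      (measurable_axisMeasure_coord f 0).aemeasurable, (h t).trans (h 0).symm⟩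
  memLp_eps := memLp_axisMeasure_coord axisEps 0
  memLp_eta k := memLp_axisMeasure_coord (axisEta b k) 0
  uncorr_eps_eta k := covariance_axisMeasure_eq_zero (axisEps_mul_axisEta b k) axisEps_not
  uncorr_eta k l hkl := covariance_axisMeasure_eq_zero (axisEta_mul_axisEta b hkl)
    (axisEta_not b k)
  odd_eps m hm _ := by
    refine (integral_axisMeasure_coord (fun x => axisEps x ^ m) 0).trans
      (integral_axisLaw_of_odd fun s j => ?_)
    simp only [axisEps_not, hm.neg_pow]
  odd_eta k m hm _ := by
    refine (integral_axisMeasure_coord (fun x => axisEta b k x ^ m) 0).trans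
      (integral_axisLaw_of_odd fun s j => ?_)
    simp only [axisEta_not, hm.neg_pow]

end AxisNoise

/-! ### The stationary process of the counterexample -/

section AxisSolution

variable {p : ℕ}

/-- The parameter of the example: the first coefficient is `1 / 8`, the others vanish. -/
noncomputable def axisTheta (p : ℕ) (k : Fin p) : ℝ := if (k : ℕ) = 0 then 1 / 8 else 0

/-- The stationary process of the example. -/
noncomputable def axisSolution (α b : Fin p → ℝ) : ℤ → (ℤ → AxisSite p) → ℝ :=
  picardLimit (axisTheta p) α (axisNoiseEps p) (axisNoiseEta b)

variable {α b : Fin p → ℝ}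

/-- The deterministic part contributes at most `1 / 8` and the noise at most `1 / 4`. The weights `2
^ k` are those that conjugation produces in the first row of the companion form. -/
theorem sum_abs_lagCoeff_axis_le (hb : ∀ k, 0 < b k)
    (hα : ∑ k : Fin p, (|α k| + 1) * b k * 2 ^ (k : ℕ) ≤ 1 / 4) (t : ℤ) (ω : ℤ → AxisSite p) :
    ∑ k : Fin p, |lagCoeff (axisTheta p) α (axisNoiseEta b) k t ω| * 2 ^ (k : ℕ) ≤ 1 / 2 := by
  have h1 : ∀ k : Fin p, |lagCoeff (axisTheta p) α (axisNoiseEta b) k t ω| * 2 ^ (k : ℕ)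
      ≤ axisTheta p k * 2 ^ (k : ℕ) + (|α k| + 1) * b k * 2 ^ (k : ℕ) := by
    intro k
    rw [← add_mul]
    refine mul_le_mul_of_nonneg_right ?_ (by positivity)
    have e1 : |axisTheta p k| = axisTheta p k := abs_of_nonneg (by
      rw [axisTheta]; split_ifs <;> norm_num)
    have e2 : |α k * axisNoiseEta b k (t - 1) ω| ≤ |α k| * b k := by
      rw [abs_mul]
      exact mul_le_mul_of_nonneg_left (abs_axisEta_le hb k _) (abs_nonneg _)
    have e3 : |axisNoiseEta b k t ω| ≤ b k := abs_axisEta_le hb k _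
    rw [lagCoeff]
    refine (abs_add_three _ _ _).trans ?_
    linarith
  have h2 : ∑ k : Fin p, axisTheta p k * 2 ^ (k : ℕ) ≤ 1 / 8 := by
    rcases Nat.eq_zero_or_pos p with rfl | hp
    · simp
    · rw [Finset.sum_eq_single (⟨0, hp⟩ : Fin p)]
      · simp [axisTheta]
      · intro k _ hk
        have : (k : ℕ) ≠ 0 := fun h => hk (Fin.ext h)
        simp [axisTheta, this]
      · simp
  refine (Finset.sum_le_sum fun k _ => h1 k).trans ?_
  rw [Finset.sum_add_distrib]
  linarith

theorem sum_abs_lagCoeff_axis_le' (hb : ∀ k, 0 < b k)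
    (hα : ∑ k : Fin p, (|α k| + 1) * b k * 2 ^ (k : ℕ) ≤ 1 / 4) (t : ℤ) (ω : ℤ → AxisSite p) :
    ∑ k : Fin p, |lagCoeff (axisTheta p) α (axisNoiseEta b) k t ω| ≤ 1 / 2 :=
  (Finset.sum_le_sum fun _ _ => le_mul_of_one_le_right (abs_nonneg _)
    (one_le_pow₀ one_le_two)).trans (sum_abs_lagCoeff_axis_le hb hα t ω)

theorem isStable_axis (hb : ∀ k, 0 < b k)
    (hα : ∑ k : Fin p, (|α k| + 1) * b k * 2 ^ (k : ℕ) ≤ 1 / 4) :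
    IsStable (axisMeasure p) (axisTheta p) α (axisNoiseEps p) (axisNoiseEta b) where
  exp_log_norm_neg := by
    -- With weights `2 ^ (-i)` the subdiagonal ones become `1 / 2`, and the first row is multiplied
    -- by `2 ^ j`. Every row sum is then at most `1 / 2`, which the unweighted row-sum norm cannot
    -- achieve when `p ≥ 2`.
    refine ⟨weightedNorm (fun i => (1 / 2 : ℝ) ^ (i : ℕ)) (fun i => by positivity),
      expLogNeg_of_le (r := 1 / 2) (by norm_num) (by norm_num) fun ω => ?_⟩
    refine weightedNorm_le _ (by norm_num) fun i => ?_
    simp only [coeffMatrix_apply]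
    by_cases hi : (i : ℕ) = 0
    · refine le_of_eq_of_le (Finset.sum_congr rfl fun j _ => ?_)
        (sum_abs_lagCoeff_axis_le hb hα 1 ω)
      rw [if_pos hi, hi, pow_zero, one_mul, abs_mul, ← inv_pow,
        abs_of_pos (show (0 : ℝ) < ((1 / 2 : ℝ)⁻¹) ^ (j : ℕ) by positivity)]
      norm_num [lagCoeff]
    · have hlt : (i : ℕ) - 1 < p := by omega
      rw [Finset.sum_eq_single (⟨(i : ℕ) - 1, hlt⟩ : Fin p)]
      · have hi' : (i : ℕ) = (i : ℕ) - 1 + 1 := by omega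
        rw [if_neg hi, if_pos hi', mul_one]
        simp only
        conv_lhs => rw [hi']
        rw [Nat.add_sub_cancel, pow_succ, mul_comm, ← mul_assoc, inv_mul_cancel₀ (by positivity)]
        norm_num
      · intro j _ hj
        have : (i : ℕ) ≠ (j : ℕ) + 1 := fun h => hj (Fin.ext (by simp only; omega))
        simp [hi, this]
      · simp
  integrable_posLog := by
    have : ∀ ω, log⁺ |axisNoiseEps p 0 ω| = 0 := fun ω =>
      (posLog_eq_zero_iff _).2 (by rw [abs_abs]; exact abs_axisEps_le _)
    simp [this]

theorem axisSolution_eq (hb : ∀ k, 0 < b k)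
    (hα : ∑ k : Fin p, (|α k| + 1) * b k * 2 ^ (k : ℕ) ≤ 1 / 4) (t : ℤ) (ω : ℤ → AxisSite p) :
    axisSolution α b t ω = ∑ k : Fin p, (axisTheta p k + α k * axisNoiseEta b k (t - 1) ω
      + axisNoiseEta b k t ω) * axisSolution α b (t - ((k : ℤ) + 1)) ω + axisNoiseEps p t ω :=
  picardLimit_eq (fun t => sum_abs_lagCoeff_axis_le' hb hα t ω) (fun _ => abs_axisEps_le _) t

theorem abs_axisSolution_le (hb : ∀ k, 0 < b k)
    (hα : ∑ k : Fin p, (|α k| + 1) * b k * 2 ^ (k : ℕ) ≤ 1 / 4) (t : ℤ) (ω : ℤ → AxisSite p) :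
    |axisSolution α b t ω| ≤ 2 :=
  abs_picardLimit_le (fun t => sum_abs_lagCoeff_axis_le' hb hα t ω) (fun _ => abs_axisEps_le _) t

theorem measurable_axisSolution (α b : Fin p → ℝ) (t : ℤ) : Measurable (axisSolution α b t) :=
  measurable_picardLimit (measurable_axisMeasure_coord axisEps)
    (fun k => measurable_axisMeasure_coord (axisEta b k)) t

theorem isRCAR_axis (hb : ∀ k, 0 < b k)
    (hα : ∑ k : Fin p, (|α k| + 1) * b k * 2 ^ (k : ℕ) ≤ 1 / 4) :
    IsRCAR (axisMeasure p) (axisTheta p) α (axisNoiseEps p) (axisNoiseEta b)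
      (axisSolution α b) where
  noise := isNoise_axis b
  stable := isStable_axis hb hα
  measurable := measurable_axisSolution α b
  recursion t := Eventually.of_forall fun ω => axisSolution_eq hb hα t ω
  stationary s := identDistrib_picardLimit (axisLaw p) Measurable.of_discrete
    (fun _ => Measurable.of_discrete) s

end AxisSolution

end RCAR

/-! ### Closure properties of bounded measurable functions -/

section BoundedMeasurable

/-- Bounded measurable functions. -/
def BddMeasurable {Ω : Type*} [MeasurableSpace Ω] (f : Ω → ℝ) : Prop :=
  Measurable f ∧ ∃ C : ℝ, ∀ ω, |f ω| ≤ C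

variable {Ω : Type*} [MeasurableSpace Ω] {f g : Ω → ℝ}

theorem BddMeasurable.add (hf : BddMeasurable f) (hg : BddMeasurable g) :
    BddMeasurable fun ω => f ω + g ω := by
  obtain ⟨hf, C, hC⟩ := hf
  obtain ⟨hg, D, hD⟩ := hg
  exact ⟨hf.add hg, C + D, fun ω => (abs_add_le _ _).trans (add_le_add (hC ω) (hD ω))⟩

theorem BddMeasurable.mul (hf : BddMeasurable f) (hg : BddMeasurable g) :
    BddMeasurable fun ω => f ω * g ω := by
  obtain ⟨hf, C, hC⟩ := hf
  obtain ⟨hg, D, hD⟩ := hg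
  refine ⟨hf.mul hg, C * D, fun ω => ?_⟩
  rw [abs_mul]
  exact mul_le_mul (hC ω) (hD ω) (abs_nonneg _) ((abs_nonneg _).trans (hC ω))

theorem BddMeasurable.const (c : ℝ) : BddMeasurable fun _ : Ω => c :=
  ⟨measurable_const, |c|, fun _ => le_rfl⟩

theorem BddMeasurable.pow (hf : BddMeasurable f) (m : ℕ) : BddMeasurable fun ω => f ω ^ m := by
  induction m with
  | zero => simpa using BddMeasurable.const 1
  | succ m ih => simpa only [pow_succ] using ih.mul hf

theorem BddMeasurable.sum {ι : Type*} (s : Finset ι) {f : ι → Ω → ℝ}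
    (hf : ∀ i, BddMeasurable (f i)) : BddMeasurable fun ω => ∑ i ∈ s, f i ω := by
  classical
  induction s using Finset.induction_on with
  | empty => simpa using BddMeasurable.const 0
  | insert i s hi ih => simpa only [Finset.sum_insert hi] using (hf i).add ih

theorem BddMeasurable.integrable {P : Measure Ω} [IsFiniteMeasure P] (hf : BddMeasurable f) :
    Integrable f P := by
  obtain ⟨hf, C, hC⟩ := hf
  exact Integrable.of_bound hf.aestronglyMeasurable C (Eventually.of_forall hC)

end BoundedMeasurable

/-! ### Closure properties of functions of the past -/

namespace RCAR

section PastMeasurable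

variable {Ω : Type*} [MeasurableSpace Ω] {P : Measure Ω} {p : ℕ} {ε : ℤ → Ω → ℝ}
  {η : Fin p → ℤ → Ω → ℝ}

theorem PastMeasurable.const (t : ℤ) (c : ℝ) : PastMeasurable P ε η t fun _ => c :=
  ⟨fun _ => c, measurable_const, EventuallyEq.rfl⟩

theorem PastMeasurable.add {t : ℤ} {V W : Ω → ℝ} (hV : PastMeasurable P ε η t V)
    (hW : PastMeasurable P ε η t W) : PastMeasurable P ε η t fun ω => V ω + W ω := by
  obtain ⟨v, hv, hVv⟩ := hV
  obtain ⟨w, hw, hWw⟩ := hW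
  exact ⟨fun z => v z + w z, hv.add hw, hVv.add hWw⟩

theorem PastMeasurable.sum {ι : Type*} (s : Finset ι) {t : ℤ} {W : ι → Ω → ℝ}
    (hW : ∀ i, PastMeasurable P ε η t (W i)) :
    PastMeasurable P ε η t fun ω => ∑ i ∈ s, W i ω := by
  classical
  induction s using Finset.induction_on with
  | empty => simpa using PastMeasurable.const t 0
  | insert i s hi ih => simpa only [Finset.sum_insert hi] using (hW i).add ih

end PastMeasurable

/-! ### Nonvanishing bias in the counterexample -/

section AxisBias

variable {p : ℕ} {α b : Fin p → ℝ}

/-- The part of `X_t` that is determined by the noises before time `t`. -/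
noncomputable def axisPred (α b : Fin p → ℝ) (t : ℤ) (ω : ℤ → AxisSite p) : ℝ :=
  ∑ k : Fin p, (axisTheta p k + α k * axisNoiseEta b k (t - 1) ω)
    * axisSolution α b (t - ((k : ℤ) + 1)) ω

/-- The multiplicity with which lag `k + 1` contributes the first autocovariance to the bias. -/
noncomputable def axisWeight (p : ℕ) (k : Fin p) : ℝ := if (k : ℕ) = 0 then 2 else 1

/-- If equal amplitudes annihilate the form, doubling the amplitude at an index with `α_l ≠ 0`
changes it by `3 α_l w_l ≠ 0`. Scaling the amplitudes down meets the smallness condition and only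
multiplies the quadratic form by a positive square. -/
theorem exists_axis_scale (hα : α ≠ 0) :
    ∃ b : Fin p → ℝ, (∀ k, 0 < b k) ∧ ∑ k : Fin p, (|α k| + 1) * b k * 2 ^ (k : ℕ) ≤ 1 / 4 ∧
      ∑ k : Fin p, α k * axisWeight p k * b k ^ 2 ≠ 0 := by
  obtain ⟨β, hβ, hQ⟩ : ∃ β : Fin p → ℝ, (∀ k, 0 < β k) ∧
      ∑ k : Fin p, α k * axisWeight p k * β k ^ 2 ≠ 0 := by
    by_cases h1 : ∑ k : Fin p, α k * axisWeight p k = 0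
    · obtain ⟨l, hl⟩ := Function.ne_iff.1 hα
      refine ⟨fun k => if k = l then 2 else 1, fun k => by dsimp only; split_ifs <;> norm_num, ?_⟩
      have e : ∀ k : Fin p, α k * axisWeight p k * (if k = l then (2 : ℝ) else 1) ^ 2
          = α k * axisWeight p k + if k = l then 3 * (α k * axisWeight p k) else 0 := by
        intro k
        split_ifs <;> ring
      have hw : axisWeight p l ≠ 0 := by
        rw [axisWeight]
        split_ifs <;> norm_num
      simp only [e, Finset.sum_add_distrib, h1, Finset.sum_ite_eq', Finset.mem_univ, if_true,
        zero_add]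
      exact mul_ne_zero three_ne_zero (mul_ne_zero hl hw)
    · exact ⟨fun _ => 1, fun _ => one_pos, by simpa using h1⟩
  set T := ∑ k : Fin p, (|α k| + 1) * β k * 2 ^ (k : ℕ)
  have hT : 0 ≤ T := Finset.sum_nonneg fun k _ => by
    have := (hβ k).le
    positivity
  -- Scaling by `1 / (4 (1 + T))` rather than `1 / (4 T)` avoids having to know that `T` is nonzero.
  have hδ : 0 < 1 / (4 * (1 + T)) := by positivity
  refine ⟨fun k => 1 / (4 * (1 + T)) * β k, fun k => mul_pos hδ (hβ k), ?_, ?_⟩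
  · have e : ∑ k : Fin p, (|α k| + 1) * (1 / (4 * (1 + T)) * β k) * 2 ^ (k : ℕ)
        = 1 / (4 * (1 + T)) * T := by
      rw [Finset.mul_sum]
      exact Finset.sum_congr rfl fun k _ => by ring
    rw [e, one_div_mul_eq_div, div_le_div_iff₀ (by positivity) (by norm_num)]
    linarith
  · have e : ∑ k : Fin p, α k * axisWeight p k * (1 / (4 * (1 + T)) * β k) ^ 2
        = (1 / (4 * (1 + T))) ^ 2 * ∑ k : Fin p, α k * axisWeight p k * β k ^ 2 := by
      rw [Finset.mul_sum]
      exact Finset.sum_congr rfl fun k _ => by ring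
    rw [e]
    exact mul_ne_zero (pow_ne_zero _ hδ.ne') hQ

variable (hp : 1 ≤ p) (hb : ∀ k, 0 < b k)
  (hα : ∑ k : Fin p, (|α k| + 1) * b k * 2 ^ (k : ℕ) ≤ 1 / 4)

include hb in
theorem bddMeasurable_axisNoiseEta (k : Fin p) (t : ℤ) : BddMeasurable (axisNoiseEta b k t) :=
  ⟨measurable_axisMeasure_coord (axisEta b k) t, b k, fun _ => abs_axisEta_le hb k _⟩

theorem bddMeasurable_axisNoiseEps (t : ℤ) : BddMeasurable (axisNoiseEps p t) :=
  ⟨measurable_axisMeasure_coord axisEps t, 1, fun _ => abs_axisEps_le _⟩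

include hb hα

theorem bddMeasurable_axisSolution (t : ℤ) : BddMeasurable (axisSolution α b t) :=
  ⟨measurable_axisSolution α b t, 2, fun ω => abs_axisSolution_le hb hα t ω⟩

theorem bddMeasurable_axisPred (t : ℤ) : BddMeasurable (axisPred α b t) :=
  BddMeasurable.sum _ fun k => ((BddMeasurable.const _).add
    ((BddMeasurable.const _).mul (bddMeasurable_axisNoiseEta hb k _))).mul
    (bddMeasurable_axisSolution hb hα _)

theorem finiteSecondMoments_axis :
    FiniteSecondMoments (axisMeasure p) (axisNoiseEta b) (axisSolution α b) := fun a _ k t =>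
  (((bddMeasurable_axisNoiseEta hb k t).pow a).mul
    ((bddMeasurable_axisSolution hb hα t).pow 2)).integrable

theorem axisSolution_eq_pred_add (t : ℤ) (ω : ℤ → AxisSite p) :
    axisSolution α b t ω = axisPred α b t ω + ∑ k : Fin p,
      axisNoiseEta b k t ω * axisSolution α b (t - ((k : ℤ) + 1)) ω + axisNoiseEps p t ω := by
  conv_lhs => rw [axisSolution_eq hb hα]
  rw [axisPred, ← Finset.sum_add_distrib]
  congr 1
  exact Finset.sum_congr rfl fun k _ => by ring

/-- Multiplying by `ε_t` removes every `η_{k,t}` term, since the noise sits on one axis at a time;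
likewise, multiplying by `η_{k,t}` leaves only its own square beside the predicted part. -/
theorem axisSolution_mul_eps (t : ℤ) (ω : ℤ → AxisSite p) :
    axisSolution α b t ω * axisNoiseEps p t ω
      = axisPred α b t ω * axisNoiseEps p t ω + axisNoiseEps p t ω * axisNoiseEps p t ω := by
  have h0 : (∑ k : Fin p, axisNoiseEta b k t ω * axisSolution α b (t - ((k : ℤ) + 1)) ω)
      * axisNoiseEps p t ω = 0 := by
    rw [Finset.sum_mul]
    refine Finset.sum_eq_zero fun k _ => ?_
    rw [mul_right_comm, mul_comm (axisNoiseEta b k t ω), axisNoiseEps, axisNoiseEta,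
      axisEps_mul_axisEta, zero_mul]
  conv_lhs => rw [axisSolution_eq_pred_add hb hα, add_mul, add_mul, h0, add_zero]

theorem axisSolution_mul_eta (k : Fin p) (t : ℤ) (ω : ℤ → AxisSite p) :
    axisSolution α b t ω * axisNoiseEta b k t ω
      = axisPred α b t ω * axisNoiseEta b k t ω + axisSolution α b (t - ((k : ℤ) + 1)) ω
        * (axisNoiseEta b k t ω * axisNoiseEta b k t ω) := by
  have h0 : (∑ j : Fin p, axisNoiseEta b j t ω * axisSolution α b (t - ((j : ℤ) + 1)) ω)
      * axisNoiseEta b k t ω = axisSolution α b (t - ((k : ℤ) + 1)) ω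
        * (axisNoiseEta b k t ω * axisNoiseEta b k t ω) := by
    rw [Finset.sum_mul, Finset.sum_eq_single k]
    · ring
    · intro j _ hj
      rw [mul_right_comm, axisNoiseEta, axisNoiseEta, axisEta_mul_axisEta b hj, zero_mul]
    · simp
  have h1 : axisNoiseEps p t ω * axisNoiseEta b k t ω = 0 := axisEps_mul_axisEta b k _
  conv_lhs => rw [axisSolution_eq_pred_add hb hα, add_mul, add_mul, h0, h1, add_zero]

include hp

theorem pastMeasurable_axisSolution {s t : ℤ} (hst : s ≤ t) :
    PastMeasurable (axisMeasure p) (axisNoiseEps p) (axisNoiseEta b) t (axisSolution α b s) :=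
  (isRCAR_axis hb hα).pastMeasurable hp (finiteSecondMoments_axis hb hα) hst

theorem pastMeasurable_axisPred (t : ℤ) :
    PastMeasurable (axisMeasure p) (axisNoiseEps p) (axisNoiseEta b) (t - 1)
      (axisPred α b t) :=
  PastMeasurable.sum _ fun k => ((PastMeasurable.const _ _).add
    ((PastMeasurable.const _ _).mul (pastMeasurable_eta le_rfl k))).mul
    (pastMeasurable_axisSolution hp hb hα (by omega))

omit hp hα hb in
theorem integral_past_mul_eps {s t : ℤ} (hst : s < t) {W : (ℤ → AxisSite p) → ℝ}
    (hW : PastMeasurable (axisMeasure p) (axisNoiseEps p) (axisNoiseEta b) s W)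
    (hWm : Measurable W) : ∫ ω, W ω * axisNoiseEps p t ω ∂(axisMeasure p) = 0 := by
  refine (hW.integral_mul (isNoise_axis b) hst hWm (φ := fun e => e.1) measurable_fst).trans ?_
  rw [(isNoise_axis b).integral_eps, mul_zero]

omit hp hα hb in
theorem integral_past_mul_eta {s t : ℤ} (hst : s < t) {W : (ℤ → AxisSite p) → ℝ}
    (hW : PastMeasurable (axisMeasure p) (axisNoiseEps p) (axisNoiseEta b) s W)
    (hWm : Measurable W) (k : Fin p) :
    ∫ ω, W ω * axisNoiseEta b k t ω ∂(axisMeasure p) = 0 := by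
  refine (hW.integral_mul (isNoise_axis b) hst hWm (measurable_vec_eta k)).trans ?_
  rw [(isNoise_axis b).integral_eta, mul_zero]

omit hp hα hb in
theorem integral_past_mul_eta_sq {s t : ℤ} (hst : s < t) {W : (ℤ → AxisSite p) → ℝ}
    (hW : PastMeasurable (axisMeasure p) (axisNoiseEps p) (axisNoiseEta b) s W)
    (hWm : Measurable W) (k : Fin p) :
    ∫ ω, W ω * (axisNoiseEta b k t ω * axisNoiseEta b k t ω) ∂(axisMeasure p)
      = (∫ ω, W ω ∂(axisMeasure p)) * (((p : ℝ) + 1)⁻¹ * b k ^ 2) := by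
  refine (hW.integral_mul (isNoise_axis b) hst hWm
    ((measurable_vec_eta k).mul (measurable_vec_eta k))).trans ?_
  congr 1
  exact (integral_axisMeasure_coord (fun x => axisEta b k x * axisEta b k x) 0).trans
    (integral_axisEta_sq b k)

omit hp hα hb in
theorem integral_past_mul_eta_cube {s t : ℤ} (hst : s < t) {W : (ℤ → AxisSite p) → ℝ}
    (hW : PastMeasurable (axisMeasure p) (axisNoiseEps p) (axisNoiseEta b) s W)
    (hWm : Measurable W) (k : Fin p) :
    ∫ ω, W ω * axisNoiseEta b k t ω ^ 3 ∂(axisMeasure p) = 0 := by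
  refine (hW.integral_mul (isNoise_axis b) hst hWm
    ((measurable_vec_eta k).pow_const 3)).trans ?_
  have := (integral_axisMeasure_coord (fun x => axisEta b k x ^ 3) 0).trans
    (integral_axisLaw_of_odd fun s j => by rw [axisEta_not]; ring)
  refine mul_eq_zero_of_right _ this

/-- The process is correlated with the simultaneous noise `ε`. -/
theorem integral_axisSolution_mul_eps_self (t : ℤ) :
    ∫ ω, axisSolution α b t ω * axisNoiseEps p t ω ∂(axisMeasure p) = ((p : ℝ) + 1)⁻¹ := by
  have hε := bddMeasurable_axisNoiseEps (p := p) t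
  have hY := bddMeasurable_axisPred hb hα t
  simp only [axisSolution_mul_eps hb hα]
  rw [integral_add (hY.mul hε).integrable (hε.mul hε).integrable,
    integral_past_mul_eps (by omega) (pastMeasurable_axisPred hp hb hα t) hY.1, zero_add]
  exact (integral_axisMeasure_coord (fun x => axisEps x * axisEps x) t).trans integral_axisEps_sq

/-- If `E[X_0²]` vanished, `X_0` would be zero almost surely, against `E[X_0 ε_0] = 1 / (p + 1)`. -/
theorem autocov_axis_zero_ne : autocov (axisMeasure p) (axisSolution α b) 0 ≠ 0 := by
  intro h0
  have hX := bddMeasurable_axisSolution hb hα 0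
  have h1 : ∫ ω, axisSolution α b 0 ω * axisSolution α b 0 ω ∂(axisMeasure p) = 0 := h0
  rw [integral_eq_zero_iff_of_nonneg (fun ω => mul_self_nonneg _) (hX.mul hX).integrable] at h1
  have h2 : ∫ ω, axisSolution α b 0 ω * axisNoiseEps p 0 ω ∂(axisMeasure p) = 0 := by
    refine integral_eq_zero_of_ae ?_
    filter_upwards [h1] with ω hω
    rw [mul_self_eq_zero.1 hω, zero_mul]
    rfl
  rw [integral_axisSolution_mul_eps_self hp hb hα] at h2
  exact absurd h2 (by positivity)

/-- The covariance matrix of the example is invertible. -/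
theorem isUnit_det_Lambda0_axis : IsUnit (Lambda0 (axisMeasure p) p (axisSolution α b)).det := by
  have h := isRCAR_axis hb hα
  rw [isUnit_iff_ne_zero]
  intro hdet
  obtain ⟨c, hc0, hc⟩ := Matrix.exists_mulVec_eq_zero_iff.2 hdet
  have hX := bddMeasurable_axisSolution hb hα
  have hV : BddMeasurable fun ω => ∑ j : Fin p, c j * axisSolution α b (-(j : ℤ)) ω :=
    BddMeasurable.sum _ fun j => (BddMeasurable.const _).mul (hX _)
  have hsq : ∫ ω, (∑ j : Fin p, c j * axisSolution α b (-(j : ℤ)) ω)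
      * (∑ j : Fin p, c j * axisSolution α b (-(j : ℤ)) ω) ∂(axisMeasure p) = 0 := by
    have hi : ∀ i j : Fin p, Integrable (fun ω => c i * axisSolution α b (-(i : ℤ)) ω
        * (c j * axisSolution α b (-(j : ℤ)) ω)) (axisMeasure p) := fun i j =>
      (((BddMeasurable.const _).mul (hX _)).mul ((BddMeasurable.const _).mul (hX _))).integrable
    simp only [Finset.sum_mul_sum]
    rw [integral_finsetSum _ fun i _ => integrable_finsetSum _ fun j _ => hi i j]
    refine Finset.sum_eq_zero fun i _ => ?_
    rw [integral_finsetSum _ fun j _ => hi i j]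
    have hci : ∑ j : Fin p, Lambda0 (axisMeasure p) p (axisSolution α b) i j * c j = 0 :=
      congrFun hc i
    rw [← mul_zero (c i), ← hci, Finset.mul_sum]
    refine Finset.sum_congr rfl fun j _ => ?_
    have e : ∀ ω, c i * axisSolution α b (-(i : ℤ)) ω * (c j * axisSolution α b (-(j : ℤ)) ω)
        = c i * c j * (axisSolution α b (-(i : ℤ)) ω * axisSolution α b (-(j : ℤ)) ω) :=
      fun ω => by ring
    simp only [e]
    rw [integral_const_mul, h.integral_mul_eq_autocov, Lambda0, Matrix.of_apply,
      show (-(i : ℤ) - -(j : ℤ)).natAbs = ((i : ℤ) - j).natAbs by omega]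
    ring
  rw [integral_eq_zero_iff_of_nonneg (fun ω => mul_self_nonneg _) (hV.mul hV).integrable] at hsq
  -- A kernel vector `c` makes `∑ c_j X_{-j}` vanish almost surely. The smallest index with `c_l ≠
  -- 0` belongs to the latest time present, so `ε_{-l}` is orthogonal to all the other terms, and
  -- pairing with it leaves `c_l / (p + 1)`.
  obtain ⟨l, hl, hmin⟩ : ∃ l, c l ≠ 0 ∧ ∀ j < l, c j = 0 := by
    obtain ⟨m, hm⟩ := Function.ne_iff.1 hc0
    obtain ⟨l, hl, hlt⟩ := WellFounded.has_min (wellFounded_lt (α := Fin p)) {j | c j ≠ 0} ⟨m, hm⟩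
    exact ⟨l, hl, fun j hj => by_contra fun hne => hlt j hne hj⟩
  have hε := bddMeasurable_axisNoiseEps (p := p) (-(l : ℤ))
  have h0 : ∫ ω, (∑ j : Fin p, c j * axisSolution α b (-(j : ℤ)) ω)
      * axisNoiseEps p (-(l : ℤ)) ω ∂(axisMeasure p) = 0 := by
    refine integral_eq_zero_of_ae ?_
    filter_upwards [hsq] with ω hω
    rw [mul_self_eq_zero.1 hω, zero_mul]
    rfl
  simp only [Finset.sum_mul, mul_assoc] at h0
  rw [integral_finsetSum _ fun j _ =>
    ((BddMeasurable.const (c j)).mul ((hX (-(j : ℤ))).mul hε)).integrable,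
    Finset.sum_eq_single l, integral_const_mul, integral_axisSolution_mul_eps_self hp hb hα] at h0
  · exact absurd h0 (mul_ne_zero hl (by positivity))
  · intro j _ hjl
    rw [integral_const_mul]
    rcases lt_or_gt_of_ne hjl with hlt | hgt
    · rw [hmin j hlt, zero_mul]
    · have hgt' : (l : ℕ) < j := hgt
      rw [integral_past_mul_eps (s := -(j : ℤ)) (by omega)
        (pastMeasurable_axisSolution hp hb hα le_rfl) (hX _).1, mul_zero]
  · simp

/-- What the predicted part omits from `X_0` consists of `ε_0` and of past values times `η_{k,0}`,
all orthogonal to `X_{-1}`. -/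
theorem integral_axisPred_mul :
    ∫ ω, axisPred α b 0 ω * axisSolution α b (-1) ω ∂(axisMeasure p)
      = autocov (axisMeasure p) (axisSolution α b) 1 := by
  have h := isRCAR_axis hb hα
  have hX := bddMeasurable_axisSolution hb hα
  have hη := bddMeasurable_axisNoiseEta hb
  have hε := bddMeasurable_axisNoiseEps (p := p) 0
  have hpast : PastMeasurable (axisMeasure p) (axisNoiseEps p) (axisNoiseEta b) (-1)
      (axisSolution α b (-1)) := pastMeasurable_axisSolution hp hb hα le_rfl
  have e1 : autocov (axisMeasure p) (axisSolution α b) 1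
      = ∫ ω, axisSolution α b 0 ω * axisSolution α b (-1) ω ∂(axisMeasure p) := by
    rw [h.integral_mul_eq_autocov]
    rfl
  have e2 : ∀ ω, axisSolution α b 0 ω * axisSolution α b (-1) ω
      = axisPred α b 0 ω * axisSolution α b (-1) ω
        + ∑ k : Fin p, axisSolution α b (0 - ((k : ℤ) + 1)) ω * axisSolution α b (-1) ω
          * axisNoiseEta b k 0 ω
        + axisSolution α b (-1) ω * axisNoiseEps p 0 ω := by
    intro ω
    conv_lhs => rw [axisSolution_eq_pred_add hb hα, add_mul, add_mul, Finset.sum_mul]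
    rw [mul_comm (axisNoiseEps p 0 ω)]
    congr 2
    exact Finset.sum_congr rfl fun k _ => by ring
  have i1 := (bddMeasurable_axisPred hb hα 0).mul (hX (-1))
  have i2 : ∀ k : Fin p, BddMeasurable fun ω => axisSolution α b (0 - ((k : ℤ) + 1)) ω
      * axisSolution α b (-1) ω * axisNoiseEta b k 0 ω := fun k => ((hX _).mul (hX _)).mul (hη k 0)
  have i3 := (hX (-1)).mul hε
  rw [e1]
  simp only [e2]
  rw [integral_add (i1.add (BddMeasurable.sum _ i2)).integrable i3.integrable,
    integral_add i1.integrable (BddMeasurable.sum _ i2).integrable,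
    integral_finsetSum _ fun k _ => (i2 k).integrable,
    integral_past_mul_eps (by norm_num) hpast (hX _).1, add_zero, Finset.sum_eq_zero, add_zero]
  intro k _
  exact integral_past_mul_eta (s := -1) (by norm_num)
    ((pastMeasurable_axisSolution hp hb hα (by omega)).mul hpast) ((hX _).mul (hX _)).1 k

/-- Only even powers of `η_{k,0}` survive integration against the past. Their coefficients reduce to
`ℓ_1` at every lag, by stationarity or through the predicted part, with `E[η_{k,0}²] = b_k² / (p +
1)`. -/
theorem integral_axisSolution_mul_mul_eta (k : Fin p) :
    ∫ ω, axisSolution α b 0 ω * axisSolution α b (-(k : ℤ)) ω * axisNoiseEta b k 0 ω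
        ∂(axisMeasure p)
      = axisWeight p k * b k ^ 2
        * (((p : ℝ) + 1)⁻¹ * autocov (axisMeasure p) (axisSolution α b) 1) := by
  have h := isRCAR_axis hb hα
  have hX := bddMeasurable_axisSolution hb hα
  have hη := bddMeasurable_axisNoiseEta hb k 0
  have hY := bddMeasurable_axisPred hb hα 0
  have hYp : PastMeasurable (axisMeasure p) (axisNoiseEps p) (axisNoiseEta b) (-1)
      (axisPred α b 0) := pastMeasurable_axisPred hp hb hα 0
  have hXp : ∀ s : ℤ, s ≤ -1 → PastMeasurable (axisMeasure p) (axisNoiseEps p) (axisNoiseEta b)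
      (-1) (axisSolution α b s) := fun s hs => pastMeasurable_axisSolution hp hb hα hs
  by_cases hk : (k : ℕ) = 0
  -- At lag one `X_0` occurs twice: with `Y` the predicted part, `X_0² η = Y² η + 2 Y X_{-1} η² +
  -- X_{-1}² η³`. The cross term is the source of the weight `2`.
  · have e : ∀ ω, axisSolution α b 0 ω * axisSolution α b (-(k : ℤ)) ω * axisNoiseEta b k 0 ω
        = axisPred α b 0 ω * axisPred α b 0 ω * axisNoiseEta b k 0 ω
          + 2 * (axisPred α b 0 ω * axisSolution α b (-1) ω
            * (axisNoiseEta b k 0 ω * axisNoiseEta b k 0 ω))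
          + axisSolution α b (-1) ω * axisSolution α b (-1) ω * axisNoiseEta b k 0 ω ^ 3 := by
      intro ω
      have h1 := axisSolution_mul_eta hb hα k 0 ω
      simp only [hk, Nat.cast_zero, zero_add, neg_zero, zero_sub] at h1 ⊢
      rw [mul_assoc, h1]
      linear_combination (axisPred α b 0 ω
        + axisSolution α b (-1) ω * axisNoiseEta b k 0 ω) * h1
    have i1 := (hY.mul hY).mul hη
    have i2 := (BddMeasurable.const (Ω := ℤ → AxisSite p) 2).mul
      ((hY.mul (hX (-1))).mul (hη.mul hη))
    have i3 := ((hX (-1)).mul (hX (-1))).mul (hη.pow 3)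
    simp only [e]
    rw [integral_add (i1.add i2).integrable i3.integrable,
      integral_add i1.integrable i2.integrable, integral_const_mul,
      integral_past_mul_eta (s := -1) (by norm_num) (hYp.mul hYp) (hY.mul hY).1,
      integral_past_mul_eta_sq (s := -1) (by norm_num) (hYp.mul (hXp _ le_rfl))
        (hY.mul (hX _)).1,
      integral_past_mul_eta_cube (s := -1) (by norm_num) ((hXp _ le_rfl).mul (hXp _ le_rfl))
        ((hX _).mul (hX _)).1,
      integral_axisPred_mul hp hb hα, axisWeight, if_pos hk]
    ring
  -- At higher lags `X_0` occurs once, and the surviving coefficient `X_{-k-1} X_{-k}` of `η²` is a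
  -- product of neighbouring values, with mean `ℓ_1`.
  · have e : ∀ ω, axisSolution α b 0 ω * axisSolution α b (-(k : ℤ)) ω * axisNoiseEta b k 0 ω
        = axisPred α b 0 ω * axisSolution α b (-(k : ℤ)) ω * axisNoiseEta b k 0 ω
          + axisSolution α b (0 - ((k : ℤ) + 1)) ω * axisSolution α b (-(k : ℤ)) ω
            * (axisNoiseEta b k 0 ω * axisNoiseEta b k 0 ω) := fun ω => by
      linear_combination axisSolution α b (-(k : ℤ)) ω * axisSolution_mul_eta hb hα k 0 ω
    have i1 := (hY.mul (hX (-(k : ℤ)))).mul hη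
    have i2 := ((hX (0 - ((k : ℤ) + 1))).mul (hX (-(k : ℤ)))).mul (hη.mul hη)
    simp only [e]
    rw [integral_add i1.integrable i2.integrable,
      integral_past_mul_eta (s := -1) (by norm_num) (hYp.mul (hXp _ (by omega)))
        (hY.mul (hX _)).1,
      integral_past_mul_eta_sq (s := -1) (by norm_num)
        ((hXp _ (by omega)).mul (hXp _ (by omega))) ((hX _).mul (hX _)).1,
      h.integral_mul_eq_autocov, axisWeight, if_neg hk,
      show (0 - ((k : ℤ) + 1) - -(k : ℤ)).natAbs = 1 by omega]
    ring

/-- The bias of the example does not vanish. -/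
theorem biasVec_axis_ne_zero (hS : ∑ k : Fin p, α k * axisWeight p k * b k ^ 2 ≠ 0) :
    biasVec (axisMeasure p) α (axisNoiseEta b) (axisSolution α b) ⟨0, hp⟩ ≠ 0 := by
  have h := isRCAR_axis hb hα
  have hbias : biasVec (axisMeasure p) α (axisNoiseEta b) (axisSolution α b) ⟨0, hp⟩
      = (∑ k : Fin p, α k * axisWeight p k * b k ^ 2)
        * (((p : ℝ) + 1)⁻¹ * autocov (axisMeasure p) (axisSolution α b) 1) := by
    rw [biasVec, Finset.sum_mul]
    refine Finset.sum_congr rfl fun k _ => ?_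
    have := integral_axisSolution_mul_mul_eta hp hb hα k
    simp only [Nat.cast_zero, neg_zero]
    rw [this]
    ring
  intro h0
  have hp1 : ((p : ℝ) + 1)⁻¹ ≠ 0 := by positivity
  have hl1 : autocov (axisMeasure p) (axisSolution α b) 1 = 0 := by
    rw [hbias] at h0
    simpa [hS, hp1] using h0
  -- With zero bias in the first entry and only the first coefficient of `θ` nonzero, the first
  -- Yule–Walker equation becomes `ℓ_1 = ℓ_0 / 8`, incompatible with `ℓ_1 = 0` and `ℓ_0 ≠ 0`.
  have hyw := congrFun (h.L1_eq hp (finiteSecondMoments_axis hb hα)) ⟨0, hp⟩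
  rw [Pi.add_apply, h0, add_zero, Matrix.mulVec, dotProduct,
    Finset.sum_eq_single (⟨0, hp⟩ : Fin p)] at hyw
  · have e1 : L1 (axisMeasure p) p (axisSolution α b) ⟨0, hp⟩
        = autocov (axisMeasure p) (axisSolution α b) 1 := rfl
    have e2 : Lambda0 (axisMeasure p) p (axisSolution α b) ⟨0, hp⟩ ⟨0, hp⟩
        = autocov (axisMeasure p) (axisSolution α b) 0 := by
      simp [Lambda0]
    rw [e1, e2, hl1, axisTheta, if_pos rfl] at hyw
    exact autocov_axis_zero_ne hp hb hα (by linarith)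
  · intro j _ hj
    have : (j : ℕ) ≠ 0 := fun h => hj (Fin.ext h)
    rw [axisTheta, if_neg this, mul_zero]
  · simp

theorem thetaStar_axis_ne (hS : ∑ k : Fin p, α k * axisWeight p k * b k ^ 2 ≠ 0) :
    thetaStar (axisMeasure p) p (axisSolution α b) ≠ axisTheta p := by
  have hdet := isUnit_det_Lambda0_axis hp hb hα
  rw [(isRCAR_axis hb hα).thetaStar_eq hp (finiteSecondMoments_axis hb hα) hdet]
  intro h
  have h0 := add_eq_left.1 h
  apply biasVec_axis_ne_zero hp hb hα hS
  rw [← Matrix.one_mulVec (biasVec _ _ _ _), ← Matrix.mul_nonsing_inv _ hdet,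
    ← Matrix.mulVec_mulVec, h0, Matrix.mulVec_zero]
  rfl

end AxisBias

end RCAR

theorem theorem2 (p : ℕ) (hp : 1 ≤ p) :
    (∀ (Ω : Type u) [MeasurableSpace Ω] (P : Measure Ω) [IsProbabilityMeasure P]
        (θ α : Fin p → ℝ) (ε : ℤ → Ω → ℝ) (η : Fin p → ℤ → Ω → ℝ) (X : ℤ → Ω → ℝ),
        RCAR.IsRCAR P θ α ε η X →
        RCAR.FiniteSecondMoments P η X →
        IsUnit (RCAR.Lambda0 P p X).det →
        (∀ᵐ ω ∂P,
          (∀ᶠ n : ℕ in atTop, IsUnit (RCAR.gram p X n ω).det) ∧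
          Tendsto (fun n : ℕ => RCAR.ols p X n ω) atTop (𝓝 (RCAR.thetaStar P p X))) ∧
        RCAR.thetaStar P p X = θ + (RCAR.Lambda0 P p X)⁻¹ *ᵥ RCAR.biasVec P α η X) ∧
    (∀ α : Fin p → ℝ, α ≠ 0 →
      ∃ (Ω : Type) (_ : MeasurableSpace Ω) (P : Measure Ω) (_ : IsProbabilityMeasure P)
        (θ : Fin p → ℝ) (ε : ℤ → Ω → ℝ) (η : Fin p → ℤ → Ω → ℝ) (X : ℤ → Ω → ℝ),
        RCAR.IsRCAR P θ α ε η X ∧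
        RCAR.FiniteSecondMoments P η X ∧
        IsUnit (RCAR.Lambda0 P p X).det ∧
        RCAR.thetaStar P p X ≠ θ ∧
        ¬ TendstoInMeasure P (fun (n : ℕ) (ω : Ω) => RCAR.ols p X n ω) atTop (fun _ => θ)) := by
  refine ⟨fun Ω _ P _ θ α ε η X h hm hdet =>
    ⟨h.ae_tendsto_ols hp hm hdet, h.thetaStar_eq hp hm hdet⟩, fun α hα => ?_⟩
  obtain ⟨b, hb, hsum, hS⟩ := RCAR.exists_axis_scale hα
  have h := RCAR.isRCAR_axis hb hsum
  have hm := RCAR.finiteSecondMoments_axis hb hsum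
  have hdet := RCAR.isUnit_det_Lambda0_axis hp hb hsum
  have hne := RCAR.thetaStar_axis_ne hp hb hsum hS
  exact ⟨_, _, RCAR.axisMeasure p, inferInstance, _, _, _, _, h, hm, hdet, hne,
    h.not_tendstoInMeasure_ols hp hm hdet hne⟩
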